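/- Let $S^1=\mathbb R/\mathbb Z$ with Lebesgue (Haar) probability measure $m$, and let $(T_\delta)_{\delta\in[0,1]}$ be a family of $C^2$ maps $T_\delta:S^1\to S^1$ with $|T_\delta'(x)|>1$ for all $x\in S^1$. Suppose there is $K\in\mathbb R$ such that $\|T_\delta-T_0\|_{C^2}\le K\delta$ for all $\delta\in[0,1]$, where $$\|T_\delta-T_0\|_{C^2}=\sup_x d\big(T_\delta(x),T_0(x)\big)+\sup_x|T_\delta'(x)-T_0'(x)|+\sup_x|T_\delta''(x)-T_0''(x)|$$ and $d$ is the quotient distance on $S^1$. Let $L_\delta$ be the transfer operator of $T_\delta$ acting on densities: for $f\in L^1(m)$, $L_\delta f$ is the density with respect to $m$ of the push-forward by $T_\delta$ of the signed measure $f\,dm$. Let $W^{1,1}$ be the space of absolutely continuous functions $f:S^1\to\mathbb R$, i.e. $f(x)=f(0)+\int_0^x f'(t)\,dt$ with $f'\in L^1$, with norm $\|f\|_{W^{1,1}}=\|f\|_1+\|f'\|_1$. Then: 1. There is a constant $C$ such that $\|(L_\delta-L_0)f\|_1\le C\delta\|f\|_{W^{1,1}}$ for all $\delta\in[0,1]$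 and all $f\in W^{1,1}$. 2. For every $\delta\in[0,1]$ the map $T_\delta$ has exactly one invariant probability density $h_\delta\in L^1(m)$ (i.e. $h_\delta\ge 0$, $\int h_\delta\,dm=1$, $L_\delta h_\delta=h_\delta$), up to equality almost everywhere, and $$\|h_0-h_\delta\|_1=O(\delta\log\delta)\qquad(\delta\to0^+).$$ -/

import Mathlib

open MeasureTheory Filter Topology Asymptotics
open scoped ENNReal

noncomputable section

/-- A `C²` expanding map of the circle `ℝ/ℤ`. The regularity and the derivative are read off on a
lift `ℝ → ℝ`; two continuous lifts differ by an integer constant, so derivatives of the lift do not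
depend on which lift is recorded. Both orientations are allowed. -/
structure ExpandingCircleMap where
  toFun : UnitAddCircle → UnitAddCircle
  lift : ℝ → ℝ
  coe_lift : ∀ x : ℝ, toFun (x : UnitAddCircle) = (lift x : UnitAddCircle)
  contDiff_lift : ContDiff ℝ 2 lift
  expanding : ∀ x : ℝ, 1 < |deriv lift x|

instance : CoeFun ExpandingCircleMap (fun _ => UnitAddCircle → UnitAddCircle) :=
  ⟨ExpandingCircleMap.toFun⟩

/-- The `C²` distance `‖T - S‖_{C²}`: the sum of the sup norms of `T - S` (measured with the
quotient norm of `ℝ/ℤ`), of `T' - S'` and of `T'' - S''`. -/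
def c2Dist (T S : ExpandingCircleMap) : ℝ≥0∞ :=
  (⨆ x : UnitAddCircle, ‖T x - S x‖ₑ)
    + (⨆ x : ℝ, ‖deriv T.lift x - deriv S.lift x‖ₑ)
    + (⨆ x : ℝ, ‖deriv (deriv T.lift) x - deriv (deriv S.lift) x‖ₑ)

/-- The transfer operator on densities: push the signed measure `f dm` forward by `T` and take the
density of the result with respect to Lebesgue measure `m` on the circle. -/
def transferOp (T : UnitAddCircle → UnitAddCircle) (f : UnitAddCircle → ℝ) :
    UnitAddCircle → ℝ :=
  SignedMeasure.rnDeriv (((volume : Measure UnitAddCircle).withDensityᵥ f).map T) volume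

theorem integrable_transferOp (T : UnitAddCircle → UnitAddCircle) (f : UnitAddCircle → ℝ) :
    Integrable (transferOp T f) volume :=
  SignedMeasure.integrable_rnDeriv _ _

/-- `f` is an absolutely continuous function on the circle with derivative `f' ∈ L¹`, that is,
`f ∈ W^{1,1}` with derivative `f'` (which is unique almost everywhere). -/
def HasW11Deriv (f f' : UnitAddCircle → ℝ) : Prop :=
  Integrable f' volume ∧
    ∀ x : ℝ, f (x : UnitAddCircle) = f 0 + ∫ t in (0 : ℝ)..x, f' (t : UnitAddCircle)

/-- The `L¹` norm on the circle (used for integrable functions). -/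
def l1Norm (f : UnitAddCircle → ℝ) : ℝ := ∫ x, |f x|

/-- `h` is a probability density in `L¹` which is invariant for `T`. -/
def IsInvariantDensity (T : UnitAddCircle → UnitAddCircle) (h : UnitAddCircle → ℝ) : Prop :=
  Integrable h volume ∧ 0 ≤ᵐ[volume] h ∧ ∫ x, h x = 1 ∧ transferOp T h =ᵐ[volume] h

end

/-! Densities in `L¹` are tested against continuous observables: the transfer operator is dual to
composition with `T`, and the `L¹` norm is the supremum of the pairings with observables bounded by
one. Derivatives of densities are used only weakly, through pairings with derivatives of test
functions.

Spectral gap by coupling. The cone `LogLipschitz a` is the weak form of `f ≥ 0`, `|f'| ≤ a f`. If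
`|T'| ≥ lam > 1` and `|T''| ≤ B`, one application of the operator replaces `a` by `a / lam + B`,
which is smaller than `a` once `a` is large (`HasBounds.logLipschitz_transfer`). A probability
density in the cone is bounded below by a positive constant (`LogLipschitz.le_pairing`), so a fixed
fraction of the uniform density can be split off from its image while the rest, normalised, stays in
the cone (`HasBounds.exists_coupling`). Differences of cone densities of mass one therefore decay
geometrically, at a rate depending only on `lam`, `B`, `a`. This yields an invariant density in the
cone. Uniqueness in all of `L¹` follows because the iterates of every `f` approach `(∫ f) h`, by
density of `C¹` functions.

Perturbation. For close maps `T`, `S` the function `(ψ ∘ T) T' - (ψ ∘ S) S'` is the derivative of `∫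
ψ` from a lift of `S` to a lift of `T`, a small function. Dividing by `S'` and moving the derivative
onto `f` bounds the difference of the operators by the distance of the maps times a norm of `f` and
of its weak derivative (`HasBounds.norm_transfer_sub_le`).

Stability. Telescoping `n` steps gives `‖h₀ - h_δ‖ ≤ 2 qⁿ + n M δ` with `q < 1` and `M` independent
of small `δ`; taking `n` of order `log δ / log q` gives `O(δ log δ)`. -/

noncomputable section

/-! ### Densities paired with continuous observables -/

/-- The Banach space of integrable densities on the circle. -/
abbrev CircleL1 : Type := Lp ℝ 1 (volume : Measure UnitAddCircle)

theorem integrable_mul_continuousMap {f : UnitAddCircle → ℝ} (hf : Integrable f volume)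
    (ψ : C(UnitAddCircle, ℝ)) : Integrable (fun x => f x * ψ x) volume :=
  hf.mul_bdd (c := ‖ψ‖) ψ.continuous.aestronglyMeasurable (ae_of_all _ ψ.norm_coe_le_norm)

/-- The duality pairing between densities and continuous observables. -/
def pairing : CircleL1 →ₗ[ℝ] C(UnitAddCircle, ℝ) →ₗ[ℝ] ℝ :=
  LinearMap.mk₂ ℝ (fun f ψ => ∫ x, f x * ψ x)
    (fun f g ψ => by
      rw [← integral_add (integrable_mul_continuousMap (L1.integrable_coeFn f) ψ)
        (integrable_mul_continuousMap (L1.integrable_coeFn g) ψ)]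
      refine integral_congr_ae ?_
      filter_upwards [Lp.coeFn_add f g] with x hx
      rw [hx, Pi.add_apply, add_mul])
    (fun c f ψ => by
      rw [smul_eq_mul, ← integral_const_mul]
      refine integral_congr_ae ?_
      filter_upwards [Lp.coeFn_smul c f] with x hx
      rw [hx, Pi.smul_apply, smul_eq_mul, mul_assoc])
    (fun f ψ χ => by
      rw [← integral_add (integrable_mul_continuousMap (L1.integrable_coeFn f) ψ)
        (integrable_mul_continuousMap (L1.integrable_coeFn f) χ)]
      simp [mul_add])
    (fun c f ψ => by
      rw [smul_eq_mul, ← integral_const_mul]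
      simp [mul_left_comm])

theorem pairing_apply (f : CircleL1) (ψ : C(UnitAddCircle, ℝ)) :
    pairing f ψ = ∫ x, f x * ψ x := rfl

theorem pairing_toL1 {f : UnitAddCircle → ℝ} (hf : Integrable f volume)
    (ψ : C(UnitAddCircle, ℝ)) : pairing (hf.toL1 f) ψ = ∫ x, f x * ψ x := by
  rw [pairing_apply]
  refine integral_congr_ae ?_
  filter_upwards [hf.coeFn_toL1] with x hx
  rw [hx]

theorem norm_eq_l1Norm (f : CircleL1) : ‖f‖ = l1Norm f := by
  rw [L1.norm_eq_integral_norm]; rfl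

theorem norm_toL1_eq_l1Norm {f : UnitAddCircle → ℝ} (hf : Integrable f volume) :
    ‖hf.toL1 f‖ = l1Norm f := by
  rw [L1.norm_of_fun_eq_integral_norm]; rfl

theorem abs_pairing_le_of_abs_le (f : CircleL1) (ψ : C(UnitAddCircle, ℝ)) {c : ℝ}
    (h : ∀ x, |ψ x| ≤ c) : |pairing f ψ| ≤ c * ‖f‖ := by
  rw [pairing_apply, L1.norm_eq_integral_norm, ← integral_const_mul]
  refine (abs_integral_le_integral_abs).trans (integral_mono ?_ ?_ fun x => ?_)
  · exact (integrable_mul_continuousMap (L1.integrable_coeFn f) ψ).abs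
  · exact (L1.integrable_coeFn f).norm.const_mul c
  · simp only [abs_mul, Real.norm_eq_abs]
    rw [mul_comm]
    exact mul_le_mul_of_nonneg_right (h x) (abs_nonneg _)

theorem abs_pairing_le (f : CircleL1) (ψ : C(UnitAddCircle, ℝ)) :
    |pairing f ψ| ≤ ‖ψ‖ * ‖f‖ :=
  abs_pairing_le_of_abs_le f ψ ψ.norm_coe_le_norm

theorem continuous_pairing (ψ : C(UnitAddCircle, ℝ)) : Continuous fun f => pairing f ψ :=
  (AddMonoidHomClass.continuous_of_bound (pairing.flip ψ) ‖ψ‖ fun f => abs_pairing_le f ψ)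

/-- The sign of `f` is replaced by a continuous function: `f` is approximated in `L¹` by a
continuous `v`, and `v / (|v| + η)` is a regularised sign with `v² / (|v| + η) ≥ |v| - η`. -/
theorem norm_le_of_pairing_le {f : CircleL1} {B : ℝ}
    (h : ∀ ψ : C(UnitAddCircle, ℝ), (∀ x, |ψ x| ≤ 1) → pairing f ψ ≤ B) : ‖f‖ ≤ B := by
  refine le_of_forall_pos_le_add fun ε hε => ?_
  obtain ⟨v, hv⟩ := (ContinuousMap.toLp_denseRange ℝ (volume : Measure UnitAddCircle) ℝ
    (p := 1) ENNReal.one_ne_top).exists_dist_lt f (ε := ε / 3) (by positivity)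
  rw [dist_eq_norm] at hv
  set g : CircleL1 := ContinuousMap.toLp 1 volume ℝ v with hg
  have hden : ∀ x, 0 < |v x| + ε / 3 := fun x => by positivity
  let ψ : C(UnitAddCircle, ℝ) := ⟨fun x => v x / (|v x| + ε / 3),
    v.continuous.div (v.continuous.abs.add continuous_const) fun x => (hden x).ne'⟩
  have hψ : ∀ x, |ψ x| ≤ 1 := fun x => by
    change |v x / (|v x| + ε / 3)| ≤ 1
    rw [abs_div, abs_of_pos (hden x), div_le_one (hden x)]
    linarith
  have hgv : (g : UnitAddCircle → ℝ) =ᵐ[volume] v := ContinuousMap.coeFn_toLp _ v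
  have h1 : ‖g‖ - ε / 3 ≤ pairing g ψ := by
    have hint : Integrable (fun x => v x) (volume : Measure UnitAddCircle) :=
      (L1.integrable_coeFn g).congr hgv
    have e1 : ‖g‖ = ∫ x, |v x| := by
      rw [L1.norm_eq_integral_norm]
      exact integral_congr_ae (by filter_upwards [hgv] with x hx; rw [hx, Real.norm_eq_abs])
    have e2 : pairing g ψ = ∫ x, v x * ψ x := by
      rw [pairing_apply]
      exact integral_congr_ae (by filter_upwards [hgv] with x hx; rw [hx])
    have e3 : ∫ x : UnitAddCircle, (|v x| - ε / 3) = (∫ x, |v x|) - ε / 3 := by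
      rw [integral_sub hint.abs (integrable_const _)]
      simp [measureReal_def]
    rw [e1, e2, ← e3]
    refine integral_mono (hint.abs.sub (integrable_const _))
      (integrable_mul_continuousMap hint ψ) fun x => ?_
    change |v x| - ε / 3 ≤ v x * (v x / (|v x| + ε / 3))
    rw [← mul_div_assoc, le_div_iff₀ (hden x), ← abs_mul_abs_self (v x)]
    nlinarith [abs_nonneg (v x)]
  have h2 : |pairing (f - g) ψ| ≤ 1 * ‖f - g‖ := abs_pairing_le_of_abs_le _ _ hψ
  have h3 : ‖f‖ ≤ ‖g‖ + ‖f - g‖ := by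
    simpa using norm_add_le g (f - g)
  have h4 : pairing f ψ = pairing (f - g) ψ + pairing g ψ := by simp
  have h5 := h ψ hψ
  have h6 := (abs_le.1 h2).1
  linarith

theorem ext_pairing {f g : CircleL1} (h : ∀ ψ, pairing f ψ = pairing g ψ) : f = g := by
  rw [← sub_eq_zero, ← norm_le_zero_iff]
  refine norm_le_of_pairing_le fun ψ _ => ?_
  simp [h ψ]

theorem norm_eq_pairing_one {f : CircleL1}
    (hf : ∀ ψ : C(UnitAddCircle, ℝ), 0 ≤ ψ → 0 ≤ pairing f ψ) : ‖f‖ = pairing f 1 := by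
  refine le_antisymm (norm_le_of_pairing_le fun ψ hψ => ?_) ?_
  · have := hf (1 - ψ) (fun x => by
      have := (abs_le.1 (hψ x)).2
      simpa using this)
    rw [map_sub] at this
    linarith
  · have := abs_pairing_le_of_abs_le f 1 (c := 1) (by simp)
    linarith [le_abs_self (pairing f 1)]

/-- Positivity against continuous observables forces `∫ |f| = ∫ f`, hence `|f| = f` almost
everywhere. -/
theorem ae_nonneg_of_pairing_nonneg {f : CircleL1}
    (hf : ∀ ψ : C(UnitAddCircle, ℝ), 0 ≤ ψ → 0 ≤ pairing f ψ) : 0 ≤ᵐ[volume] f := by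
  have h := norm_eq_pairing_one hf
  rw [L1.norm_eq_integral_norm, pairing_apply, ← sub_eq_zero] at h
  simp only [ContinuousMap.one_apply, mul_one] at h
  have hi := L1.integrable_coeFn f
  rw [← integral_sub hi.norm hi] at h
  have h2 := (integral_eq_zero_iff_of_nonneg (f := fun y => ‖f y‖ - f y)
    (fun x => sub_nonneg.2 (le_abs_self _)) (hi.norm.sub hi)).1 h
  filter_upwards [h2] with x hx
  have : |f x| = f x := by simpa [sub_eq_zero] using hx
  change 0 ≤ f x
  rw [← this]
  exact abs_nonneg _

/-! ### The transfer operator as dual of the Koopman operator -/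

namespace ExpandingCircleMap

variable (T : ExpandingCircleMap)

theorem continuous_toFun : Continuous T := by
  have h : (T : UnitAddCircle → UnitAddCircle) ∘ ((↑) : ℝ → UnitAddCircle)
      = fun x => (T.lift x : UnitAddCircle) := funext T.coe_lift
  refine (QuotientAddGroup.isQuotientMap_mk (N := AddSubgroup.zmultiples (1 : ℝ))).continuous_iff.2 ?_
  change Continuous ((T : UnitAddCircle → UnitAddCircle) ∘ ((↑) : ℝ → UnitAddCircle))
  rw [h]
  exact (AddCircle.continuous_mk' 1).comp T.contDiff_lift.continuous

theorem hasDerivAt_lift (x : ℝ) : HasDerivAt T.lift (deriv T.lift x) x :=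
  (T.contDiff_lift.differentiable (by norm_num) x).hasDerivAt

theorem contDiff_deriv_lift : ContDiff ℝ 1 (deriv T.lift) := by
  have : ContDiff ℝ (1 + 1) T.lift := T.contDiff_lift
  exact (contDiff_succ_iff_deriv.1 this).2.2

theorem hasDerivAt_deriv_lift (x : ℝ) :
    HasDerivAt (deriv T.lift) (deriv (deriv T.lift) x) x :=
  (T.contDiff_deriv_lift.differentiable (by norm_num) x).hasDerivAt

theorem deriv_lift_ne_zero (x : ℝ) : deriv T.lift x ≠ 0 := fun h => by
  have := T.expanding x
  rw [h, abs_zero] at this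
  linarith

theorem antilipschitzWith_lift : AntilipschitzWith 1 T.lift := by
  refine AntilipschitzWith.of_le_mul_dist fun x y => ?_
  rw [NNReal.coe_one, one_mul]
  wlog hxy : x < y generalizing x y
  · rcases (not_lt.1 hxy).eq_or_lt with rfl | h
    · simp
    · rw [dist_comm x, dist_comm (T.lift x)]
      exact this y x h
  obtain ⟨c, -, hc⟩ := exists_deriv_eq_slope T.lift hxy T.contDiff_lift.continuous.continuousOn
    (T.contDiff_lift.differentiable (by norm_num)).differentiableOn
  have h1 := T.expanding c
  have h0 : 0 < y - x := sub_pos.2 hxy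
  rw [hc, abs_div, abs_of_pos h0, lt_div_iff₀ h0, one_mul] at h1
  rw [dist_comm x, dist_comm (T.lift x), Real.dist_eq, Real.dist_eq, abs_of_pos h0]
  exact h1.le

theorem volume_preimage_mk_eq_zero {s : Set UnitAddCircle} (hs : volume s = 0) :
    volume (((↑) : ℝ → UnitAddCircle) ⁻¹' s) = 0 := by
  have hU : (((↑) : ℝ → UnitAddCircle) ⁻¹' s)
      = ⋃ n : ℤ, (((↑) : ℝ → UnitAddCircle) ⁻¹' s) ∩ Set.Ioc (n : ℝ) (n + 1) := by
    rw [← Set.inter_iUnion, iUnion_Ioc_intCast, Set.inter_univ]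
  rw [hU]
  refine measure_iUnion_null fun n => ?_
  have := (UnitAddCircle.measurePreserving_mk (n : ℝ)).quasiMeasurePreserving.preimage_null hs
  rwa [Measure.restrict_apply₀'] at this
  exact measurableSet_Ioc.nullMeasurableSet

/-- The lift does not decrease distances, so preimages under it do not increase one-dimensional
Hausdorff measure, which is Lebesgue measure on the line. -/
theorem volume_preimage_eq_zero {s : Set UnitAddCircle} (hm : MeasurableSet s)
    (hs : volume s = 0) : volume (T ⁻¹' s) = 0 := by
  have h1 : volume (T.lift ⁻¹' (((↑) : ℝ → UnitAddCircle) ⁻¹' s)) = 0 := by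
    have := T.antilipschitzWith_lift.hausdorffMeasure_preimage_le zero_le_one
      (((↑) : ℝ → UnitAddCircle) ⁻¹' s)
    rw [hausdorffMeasure_real, volume_preimage_mk_eq_zero hs, mul_zero] at this
    exact le_antisymm this zero_le
  have h2 := UnitAddCircle.measurePreserving_mk 0
  rw [← h2.measure_preimage (T.continuous_toFun.measurable hm).nullMeasurableSet]
  refine le_antisymm ((Measure.restrict_apply_le _ _).trans ?_) zero_le
  rw [← h1]
  refine le_of_eq (congrArg _ ?_)
  ext x
  simp [T.coe_lift]

/-- `rnDeriv` sees only the absolutely continuous part of the push-forward; since preimages of null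
sets are null, there is no singular part to lose. -/
theorem setIntegral_transferOp {f : UnitAddCircle → ℝ} (hf : Integrable f volume)
    {s : Set UnitAddCircle} (hs : MeasurableSet s) :
    ∫ x in s, transferOp T f x = ∫ x in T ⁻¹' s, f x := by
  have hT := T.continuous_toFun.measurable
  have hac : ((volume : Measure UnitAddCircle).withDensityᵥ f).map T
      ≪ᵥ (volume : Measure UnitAddCircle).toENNRealVectorMeasure := by
    refine VectorMeasure.AbsolutelyContinuous.mk fun i hi h0 => ?_
    rw [Measure.toENNRealVectorMeasure_apply_measurable hi] at h0
    rw [VectorMeasure.map_apply _ hT hi, withDensityᵥ_apply hf (hT hi),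
      Measure.restrict_zero_set (T.volume_preimage_eq_zero hi h0), integral_zero_measure]
  have h := SignedMeasure.withDensityᵥ_rnDeriv_eq _ _ hac
  have h' := congrArg (fun v => v s) h
  rw [withDensityᵥ_apply (SignedMeasure.integrable_rnDeriv _ _) hs,
    VectorMeasure.map_apply _ hT hs, withDensityᵥ_apply hf (hT hs)] at h'
  exact h'

theorem transferOp_nonneg {f : UnitAddCircle → ℝ} (hf : Integrable f volume)
    (h0 : 0 ≤ᵐ[volume] f) : 0 ≤ᵐ[volume] transferOp T f := by
  refine ae_nonneg_of_forall_setIntegral_nonneg (integrable_transferOp T f) fun s hs _ => ?_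
  rw [T.setIntegral_transferOp hf hs]
  exact setIntegral_nonneg_of_ae h0

theorem integral_transferOp_mul_of_nonneg {f : UnitAddCircle → ℝ} (hf : Integrable f volume)
    (h0 : 0 ≤ᵐ[volume] f) (ψ : C(UnitAddCircle, ℝ)) :
    ∫ x, transferOp T f x * ψ x = ∫ x, f x * ψ (T x) := by
  have hT := T.continuous_toFun.measurable
  have hL := integrable_transferOp T f
  have hL0 := T.transferOp_nonneg hf h0
  have key : (volume : Measure UnitAddCircle).withDensity (fun x => ENNReal.ofReal (transferOp T f x))
      = ((volume : Measure UnitAddCircle).withDensity (fun x => ENNReal.ofReal (f x))).map T := by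
    ext s hs
    rw [Measure.map_apply hT hs, withDensity_apply _ hs, withDensity_apply _ (hT hs),
      ← ofReal_integral_eq_lintegral_ofReal hL.integrableOn (ae_restrict_of_ae hL0),
      ← ofReal_integral_eq_lintegral_ofReal hf.integrableOn (ae_restrict_of_ae h0),
      T.setIntegral_transferOp hf hs]
  have dens : ∀ (g : UnitAddCircle → ℝ) (χ : UnitAddCircle → ℝ), Integrable g volume →
      0 ≤ᵐ[volume] g → ∫ x, χ x ∂((volume : Measure UnitAddCircle).withDensity
        (fun x => ENNReal.ofReal (g x))) = ∫ x, g x * χ x := by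
    intro g χ hg hg0
    rw [integral_withDensity_eq_integral_toReal_smul₀ hg.aemeasurable.ennreal_ofReal
      (ae_of_all _ fun _ => ENNReal.ofReal_lt_top)]
    refine integral_congr_ae ?_
    filter_upwards [hg0] with x hx
    rw [ENNReal.toReal_ofReal hx, smul_eq_mul]
  rw [← dens _ _ hL hL0, key, integral_map hT.aemeasurable ψ.continuous.aestronglyMeasurable,
    dens _ (fun x => ψ (T x)) hf h0]

theorem integral_transferOp_mul {f : UnitAddCircle → ℝ} (hf : Integrable f volume)
    (ψ : C(UnitAddCircle, ℝ)) :
    ∫ x, transferOp T f x * ψ x = ∫ x, f x * ψ (T x) := by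
  have hp := hf.pos_part
  have hn := hf.neg_part
  have hLp := integrable_transferOp T fun x => max (f x) 0
  have hLn := integrable_transferOp T fun x => max (-f x) 0
  have hdec : ∀ x, f x = max (f x) 0 - max (-f x) 0 := fun x => by
    rcases le_total (f x) 0 with h | h <;> simp [h]
  have key : transferOp T f =ᵐ[volume]
      fun x => transferOp T (fun x => max (f x) 0) x - transferOp T (fun x => max (-f x) 0) x := by
    refine (integrable_transferOp T f).ae_eq_of_forall_setIntegral_eq _ _ (hLp.sub hLn)
      fun s hs _ => ?_
    rw [integral_sub hLp.integrableOn hLn.integrableOn, T.setIntegral_transferOp hf hs,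
      T.setIntegral_transferOp hp hs, T.setIntegral_transferOp hn hs,
      ← integral_sub hp.integrableOn hn.integrableOn]
    exact integral_congr_ae (ae_of_all _ hdec)
  let χ : C(UnitAddCircle, ℝ) := ψ.comp ⟨T, T.continuous_toFun⟩
  calc ∫ x, transferOp T f x * ψ x
      = ∫ x, (transferOp T (fun x => max (f x) 0) x * ψ x
          - transferOp T (fun x => max (-f x) 0) x * ψ x) := by
        refine integral_congr_ae ?_
        filter_upwards [key] with x hx
        rw [hx, sub_mul]
    _ = ∫ x, (max (f x) 0 * χ x - max (-f x) 0 * χ x) := by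
        rw [integral_sub (integrable_mul_continuousMap hLp ψ) (integrable_mul_continuousMap hLn ψ),
          integral_sub (integrable_mul_continuousMap hp χ) (integrable_mul_continuousMap hn χ),
          T.integral_transferOp_mul_of_nonneg hp (ae_of_all _ fun _ => le_max_right _ _),
          T.integral_transferOp_mul_of_nonneg hn (ae_of_all _ fun _ => le_max_right _ _)]
        rfl
    _ = ∫ x, f x * ψ (T x) := by
        refine integral_congr_ae (ae_of_all _ fun x => ?_)
        simp only [← sub_mul, ← hdec]
        rfl

/-- The Koopman operator on continuous observables. -/
def koopman (ψ : C(UnitAddCircle, ℝ)) : C(UnitAddCircle, ℝ) :=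
  ψ.comp ⟨T, T.continuous_toFun⟩

@[simp]
theorem koopman_apply (ψ : C(UnitAddCircle, ℝ)) (x : UnitAddCircle) :
    T.koopman ψ x = ψ (T x) := rfl

theorem pairing_toL1_transferOp {f : UnitAddCircle → ℝ} (hf : Integrable f volume)
    (ψ : C(UnitAddCircle, ℝ)) :
    pairing ((integrable_transferOp T f).toL1 _) ψ = pairing (hf.toL1 f) (T.koopman ψ) := by
  rw [pairing_toL1, pairing_toL1, T.integral_transferOp_mul hf]
  rfl

theorem pairing_toL1_transferOp_coe (f : CircleL1) (ψ : C(UnitAddCircle, ℝ)) :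
    pairing ((integrable_transferOp T f).toL1 _) ψ = pairing f (T.koopman ψ) := by
  rw [T.pairing_toL1_transferOp (L1.integrable_coeFn f), Integrable.toL1_coeFn]

/-- The transfer operator as a bounded operator on `L¹`. -/
def transfer : CircleL1 →L[ℝ] CircleL1 :=
  LinearMap.mkContinuous
    { toFun := fun f => (integrable_transferOp T f).toL1 _
      map_add' := fun f g => ext_pairing fun ψ => by
        simp only [map_add, LinearMap.add_apply, pairing_toL1_transferOp_coe]
      map_smul' := fun c f => ext_pairing fun ψ => by
        simp only [map_smul, LinearMap.smul_apply, pairing_toL1_transferOp_coe, RingHom.id_apply] }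
    1 fun f => by
      refine norm_le_of_pairing_le fun ψ hψ => ?_
      simp only [LinearMap.coe_mk, AddHom.coe_mk, pairing_toL1_transferOp_coe]
      exact (le_abs_self _).trans (abs_pairing_le_of_abs_le _ _ fun x => hψ _)

theorem pairing_transfer (f : CircleL1) (ψ : C(UnitAddCircle, ℝ)) :
    pairing (T.transfer f) ψ = pairing f (T.koopman ψ) :=
  T.pairing_toL1_transferOp_coe f ψ

theorem norm_transfer_le (f : CircleL1) : ‖T.transfer f‖ ≤ ‖f‖ := by
  refine norm_le_of_pairing_le fun ψ hψ => ?_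
  rw [pairing_transfer]
  simpa using (le_abs_self _).trans (abs_pairing_le_of_abs_le f (T.koopman ψ) fun x => hψ _)

theorem toL1_transferOp {f : UnitAddCircle → ℝ} (hf : Integrable f volume) :
    (integrable_transferOp T f).toL1 _ = T.transfer (hf.toL1 f) :=
  ext_pairing fun ψ => by rw [T.pairing_toL1_transferOp hf, pairing_transfer]

theorem isInvariantDensity_iff {h : UnitAddCircle → ℝ} :
    IsInvariantDensity T h ↔ ∃ hh : Integrable h volume, 0 ≤ᵐ[volume] h ∧
      pairing (hh.toL1 h) 1 = 1 ∧ T.transfer (hh.toL1 h) = hh.toL1 h := by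
  constructor
  · rintro ⟨hh, h0, h1, h2⟩
    refine ⟨hh, h0, ?_, ?_⟩
    · rw [pairing_toL1]
      simpa using h1
    · rw [← T.toL1_transferOp hh, Integrable.toL1_eq_toL1_iff]
      exact h2
  · rintro ⟨hh, h0, h1, h2⟩
    refine ⟨hh, h0, ?_, ?_⟩
    · rw [pairing_toL1] at h1
      simpa using h1
    · rwa [← T.toL1_transferOp hh, Integrable.toL1_eq_toL1_iff] at h2

end ExpandingCircleMap

/-! ### Differentiation on the circle -/

/-- The continuous function on the circle induced by a continuous `1`-periodic function. -/
def circleMapOfPeriodic (g : ℝ → ℝ) (hp : Function.Periodic g 1) (hc : Continuous g) :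
    C(UnitAddCircle, ℝ) :=
  ⟨hp.lift, (QuotientAddGroup.isQuotientMap_mk (N := AddSubgroup.zmultiples (1 : ℝ))).continuous_iff.2 hc⟩

@[simp]
theorem circleMapOfPeriodic_coe (g : ℝ → ℝ) (hp : Function.Periodic g 1) (hc : Continuous g)
    (x : ℝ) : circleMapOfPeriodic g hp hc (x : UnitAddCircle) = g x := rfl

theorem circle_forall {p : UnitAddCircle → Prop} : (∀ x, p x) ↔ ∀ x : ℝ, p (x : UnitAddCircle) :=
  ⟨fun h x => h x, fun h x => QuotientAddGroup.induction_on x h⟩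

theorem coe_add_one (x : ℝ) : ((x + 1 : ℝ) : UnitAddCircle) = x := by
  rw [AddCircle.coe_add, AddCircle.coe_period, add_zero]

/-- `φ'` is the derivative of `φ` on the circle. -/
def IsCircleDeriv (φ φ' : C(UnitAddCircle, ℝ)) : Prop :=
  ∀ x : ℝ, HasDerivAt (fun y : ℝ => φ (y : UnitAddCircle)) (φ' (x : UnitAddCircle)) x

theorem coe_unitAddCircle_eq_iff {x y : ℝ} :
    (x : UnitAddCircle) = y ↔ ∃ n : ℤ, x = y + n := by
  rw [← sub_eq_zero, ← AddCircle.coe_sub, AddCircle.coe_eq_zero_iff]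
  simp only [zsmul_eq_mul, mul_one]
  exact exists_congr fun n => by rw [eq_sub_iff_add_eq, add_comm, eq_comm]

namespace IsCircleDeriv

variable {φ φ' χ χ' : C(UnitAddCircle, ℝ)}

theorem mul (h : IsCircleDeriv φ φ') (k : IsCircleDeriv χ χ') :
    IsCircleDeriv (φ * χ) (φ' * χ + φ * χ') := fun x => (h x).mul (k x)

theorem add (h : IsCircleDeriv φ φ') (k : IsCircleDeriv χ χ') :
    IsCircleDeriv (φ + χ) (φ' + χ') := fun x => (h x).add (k x)

theorem const (c : ℝ) : IsCircleDeriv (ContinuousMap.const _ c) 0 :=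
  fun x => hasDerivAt_const x c

theorem sub_const (h : IsCircleDeriv φ φ') (c : ℝ) :
    IsCircleDeriv (φ - ContinuousMap.const _ c) φ' := fun x => (h x).sub_const c

theorem integral_eq_zero (h : IsCircleDeriv φ φ') : ∫ x, φ' x = 0 := by
  rw [← UnitAddCircle.intervalIntegral_preimage 0, intervalIntegral.integral_eq_sub_of_hasDerivAt
    (fun x _ => h x)]
  · rw [coe_add_one, sub_self]
  · exact (φ'.continuous.comp (AddCircle.continuous_mk' 1)).intervalIntegrable _ _

end IsCircleDeriv

/-- As `c < 1 / 2`, the function never takes a half-integer value, so by the intermediate value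
theorem its nearest integer cannot change. With `c = 0` this gives the degree of a map; with small
`c` it aligns the lifts of two close maps. -/
theorem exists_int_of_forall_near_int {e : ℝ → ℝ} (he : Continuous e) {c : ℝ} (hc : c < 1 / 2)
    (h : ∀ x, ∃ n : ℤ, |e x - n| ≤ c) : ∃ n : ℤ, ∀ x, |e x - n| ≤ c := by
  have half : ∀ (n : ℤ) (x : ℝ), e x ≠ n + 1 / 2 := by
    intro n x hx
    obtain ⟨m, hm⟩ := h x
    rw [hx, abs_le] at hm
    rcases le_or_gt m n with hmn | hmn
    · have : (m : ℝ) ≤ n := by exact_mod_cast hmn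
      linarith
    · have : (n : ℝ) + 1 ≤ m := by exact_mod_cast hmn
      linarith
  have cross : ∀ (n : ℤ) (x y : ℝ), e x < n + 1 / 2 → e y < n + 1 / 2 := by
    intro n x y hx
    by_contra hy
    obtain ⟨z, hz⟩ := mem_range_of_exists_le_of_exists_ge he ⟨x, hx.le⟩ ⟨y, not_lt.1 hy⟩
    exact half n z hz
  obtain ⟨n, hn⟩ := h 0
  refine ⟨n, fun x => ?_⟩
  obtain ⟨m, hm⟩ := h x
  rw [abs_le] at hn hm
  rcases lt_trichotomy m n with hmn | rfl | hmn
  · have : (m : ℝ) + 1 ≤ n := by exact_mod_cast hmn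
    have := cross m x 0 (by linarith)
    linarith
  · exact abs_le.2 hm
  · have : (n : ℝ) + 1 ≤ m := by exact_mod_cast hmn
    have := cross n 0 x (by linarith)
    linarith

/-! ### Degree, derivatives and uniform bounds of an expanding map -/

namespace ExpandingCircleMap

variable (T : ExpandingCircleMap)

theorem exists_lift_add_one (x : ℝ) : ∃ d : ℤ, T.lift (x + 1) = T.lift x + d := by
  have h : ((T.lift (x + 1) : ℝ) : UnitAddCircle) = T.lift x := by
    rw [← T.coe_lift, ← T.coe_lift, coe_add_one]
  exact coe_unitAddCircle_eq_iff.1 h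

theorem exists_degree : ∃ d : ℤ, ∀ x, T.lift (x + 1) = T.lift x + d := by
  have hc := T.contDiff_lift.continuous
  obtain ⟨d, hd⟩ := exists_int_of_forall_near_int (e := fun x => T.lift (x + 1) - T.lift x)
    (by fun_prop) (c := 0) (by norm_num) fun x => by
      obtain ⟨n, hn⟩ := T.exists_lift_add_one x
      exact ⟨n, by rw [hn]; norm_num⟩
  refine ⟨d, fun x => ?_⟩
  have := abs_nonpos_iff.1 (hd x)
  linarith

theorem periodic_deriv_lift : Function.Periodic (deriv T.lift) 1 := fun x => by
  obtain ⟨d, hd⟩ := T.exists_degree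
  rw [← deriv_comp_add_const, funext hd]
  simp

theorem periodic_deriv_deriv_lift : Function.Periodic (deriv (deriv T.lift)) 1 := fun x => by
  rw [← deriv_comp_add_const, funext T.periodic_deriv_lift]

theorem continuous_deriv_deriv_lift : Continuous (deriv (deriv T.lift)) :=
  T.contDiff_deriv_lift.continuous_deriv (by norm_num)

/-- The derivative as a function on the circle. -/
def circleDeriv : C(UnitAddCircle, ℝ) :=
  circleMapOfPeriodic (deriv T.lift) T.periodic_deriv_lift T.contDiff_deriv_lift.continuous

/-- The second derivative as a function on the circle. -/
def circleDeriv₂ : C(UnitAddCircle, ℝ) :=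
  circleMapOfPeriodic (deriv (deriv T.lift)) T.periodic_deriv_deriv_lift
    T.continuous_deriv_deriv_lift

@[simp]
theorem circleDeriv_coe (x : ℝ) : T.circleDeriv (x : UnitAddCircle) = deriv T.lift x := rfl

theorem circleDeriv_ne_zero (x : UnitAddCircle) : T.circleDeriv x ≠ 0 :=
  (circle_forall (p := fun y => T.circleDeriv y ≠ 0)).2 T.deriv_lift_ne_zero x

/-- The reciprocal of the derivative, as a function on the circle. -/
def invDeriv : C(UnitAddCircle, ℝ) :=
  ⟨fun x => (T.circleDeriv x)⁻¹, T.circleDeriv.continuous.inv₀ T.circleDeriv_ne_zero⟩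

/-- The derivative of the reciprocal of the derivative. -/
def distortion : C(UnitAddCircle, ℝ) :=
  ⟨fun x => -T.circleDeriv₂ x / T.circleDeriv x ^ 2,
    T.circleDeriv₂.continuous.neg.div (T.circleDeriv.continuous.pow 2)
      fun x => pow_ne_zero 2 (T.circleDeriv_ne_zero x)⟩

theorem invDeriv_coe (x : ℝ) : T.invDeriv (x : UnitAddCircle) = (deriv T.lift x)⁻¹ := rfl

theorem isCircleDeriv_invDeriv : IsCircleDeriv T.invDeriv T.distortion := fun x =>
  (T.hasDerivAt_deriv_lift x).inv (T.deriv_lift_ne_zero x)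

theorem isCircleDeriv_koopman {φ φ' : C(UnitAddCircle, ℝ)} (h : IsCircleDeriv φ φ') :
    IsCircleDeriv (T.koopman φ) (T.koopman φ' * T.circleDeriv) := fun x => by
  have := (h (T.lift x)).comp x (T.hasDerivAt_lift x)
  simp only [Function.comp_def, ← T.coe_lift] at this
  exact this

/-- Uniform expansion rate `lam` and bound `B` on the second derivative. -/
structure HasBounds (lam B : ℝ) : Prop where
  one_lt : 1 < lam
  nonneg : 0 ≤ B
  le_deriv : ∀ x, lam ≤ |deriv T.lift x|
  deriv₂_le : ∀ x, |deriv (deriv T.lift) x| ≤ B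

theorem exists_hasBounds : ∃ lam B, T.HasBounds lam B := by
  obtain ⟨x₀, -, hx₀⟩ := isCompact_univ.exists_isMinOn (s := (Set.univ : Set UnitAddCircle))
    Set.univ_nonempty (T.circleDeriv.continuous.abs.continuousOn)
  refine ⟨|T.circleDeriv x₀|, ‖T.circleDeriv₂‖, ?_, norm_nonneg _, fun x => ?_, fun x => ?_⟩
  · exact (circle_forall (p := fun y => 1 < |T.circleDeriv y|)).2 T.expanding x₀
  · exact hx₀ (Set.mem_univ (x : UnitAddCircle))
  · exact T.circleDeriv₂.norm_coe_le_norm x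

variable {T} {lam B : ℝ}

theorem HasBounds.abs_invDeriv_le (h : T.HasBounds lam B) (x : UnitAddCircle) :
    |T.invDeriv x| ≤ 1 / lam := by
  revert x
  rw [circle_forall]
  intro x
  rw [invDeriv_coe, abs_inv, ← one_div]
  exact one_div_le_one_div_of_le (by linarith [h.one_lt]) (h.le_deriv x)

theorem HasBounds.abs_invDeriv_le_one (h : T.HasBounds lam B) (x : UnitAddCircle) :
    |T.invDeriv x| ≤ 1 :=
  (h.abs_invDeriv_le x).trans ((div_le_one (by linarith [h.one_lt])).2 h.one_lt.le)

theorem HasBounds.abs_distortion_le (h : T.HasBounds lam B) (x : UnitAddCircle) :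
    |T.distortion x| ≤ B := by
  revert x
  rw [circle_forall]
  intro x
  change |-deriv (deriv T.lift) x / deriv T.lift x ^ 2| ≤ B
  have h1 := T.expanding x
  rw [abs_div, abs_neg, abs_pow, div_le_iff₀ (by positivity)]
  have h2 : 1 ≤ |deriv T.lift x| ^ 2 := one_le_pow₀ h1.le
  nlinarith [h.deriv₂_le x, h.nonneg]

end ExpandingCircleMap

/-! ### The cone of log-Lipschitz densities -/

/-- Nonnegative densities whose logarithmic derivative is bounded by `a`, in the weak sense. -/
structure LogLipschitz (a : ℝ) (f : CircleL1) : Prop where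
  nonneg : ∀ ψ : C(UnitAddCircle, ℝ), 0 ≤ ψ → 0 ≤ pairing f ψ
  deriv_le : ∀ φ φ', IsCircleDeriv φ φ' → |pairing f φ'| ≤ a * pairing f |φ|

/-- The weak derivative of `f` is a measure of total variation at most `V`. -/
def HasVariationLE (V : ℝ) (f : CircleL1) : Prop :=
  ∀ φ φ', IsCircleDeriv φ φ' → |pairing f φ'| ≤ V * ‖φ‖

/-- The constant density `1`. -/
def uniformDensity : CircleL1 := (integrable_const (1 : ℝ)).toL1 _

theorem pairing_uniformDensity (ψ : C(UnitAddCircle, ℝ)) :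
    pairing uniformDensity ψ = ∫ x, ψ x := by
  simp [uniformDensity, pairing_toL1]

theorem pairing_uniformDensity_one : pairing uniformDensity 1 = 1 := by
  simp [pairing_uniformDensity, measureReal_def]

theorem pairing_mono_of_nonneg {f : CircleL1}
    (hf : ∀ ψ : C(UnitAddCircle, ℝ), 0 ≤ ψ → 0 ≤ pairing f ψ) {ψ χ : C(UnitAddCircle, ℝ)}
    (h : ∀ x, ψ x ≤ χ x) : pairing f ψ ≤ pairing f χ := by
  have := hf (χ - ψ) fun x => by simpa using h x
  rw [map_sub] at this
  linarith

theorem abs_pairing_le_of_nonneg {f : CircleL1}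
    (hf : ∀ ψ : C(UnitAddCircle, ℝ), 0 ≤ ψ → 0 ≤ pairing f ψ) {ψ χ : C(UnitAddCircle, ℝ)}
    (h : ∀ x, |ψ x| ≤ χ x) : |pairing f ψ| ≤ pairing f χ := by
  rw [abs_le]
  constructor
  · have := pairing_mono_of_nonneg hf (ψ := -ψ) (χ := χ) fun x => (neg_le_abs _).trans (h x)
    rw [map_neg] at this
    linarith
  · exact pairing_mono_of_nonneg hf fun x => (le_abs_self _).trans (h x)

namespace LogLipschitz

variable {a : ℝ} {f : CircleL1}

theorem mono {b : ℝ} (hf : LogLipschitz a f) (hab : a ≤ b) : LogLipschitz b f where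
  nonneg := hf.nonneg
  deriv_le φ φ' h := (hf.deriv_le φ φ' h).trans
    (mul_le_mul_of_nonneg_right hab (hf.nonneg _ (abs_nonneg φ)))

theorem smul (hf : LogLipschitz a f) {c : ℝ} (hc : 0 ≤ c) : LogLipschitz a (c • f) where
  nonneg ψ hψ := by
    simpa using mul_nonneg hc (hf.nonneg ψ hψ)
  deriv_le φ φ' h := by
    simp only [map_smul, LinearMap.smul_apply, smul_eq_mul, abs_mul, abs_of_nonneg hc]
    nlinarith [hf.deriv_le φ φ' h]

theorem hasVariationLE (hf : LogLipschitz a f) (ha : 0 ≤ a) : HasVariationLE (a * ‖f‖) f := by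
  intro φ φ' h
  have h1 := abs_pairing_le_of_abs_le f |φ| (c := ‖φ‖) fun x => by
    simpa using φ.norm_coe_le_norm x
  calc |pairing f φ'| ≤ a * pairing f |φ| := hf.deriv_le φ φ' h
    _ ≤ a * (‖φ‖ * ‖f‖) := mul_le_mul_of_nonneg_left ((le_abs_self _).trans h1) ha
    _ = a * ‖f‖ * ‖φ‖ := by ring

end LogLipschitz

theorem logLipschitz_uniformDensity {a : ℝ} (ha : 0 ≤ a) : LogLipschitz a uniformDensity where
  nonneg ψ hψ := by
    rw [pairing_uniformDensity]
    exact integral_nonneg hψ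
  deriv_le φ φ' h := by
    rw [pairing_uniformDensity, h.integral_eq_zero, abs_zero, pairing_uniformDensity]
    exact mul_nonneg ha (integral_nonneg fun x => abs_nonneg (φ x))

/-- The product rule gives `φ' ∘ T = ((φ ∘ T) / T')' - (φ ∘ T) (1 / T')'`. The cone condition for
`f` applies to the first term, where `1 / |T'|` gains the factor `1 / lam`; the second is bounded
directly and costs `B`. -/
theorem ExpandingCircleMap.HasBounds.logLipschitz_transfer {T : ExpandingCircleMap}
    {lam B a : ℝ} (hT : T.HasBounds lam B) (ha : 0 ≤ a) {f : CircleL1} (hf : LogLipschitz a f) :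
    LogLipschitz (a / lam + B) (T.transfer f) where
  nonneg ψ hψ := by
    rw [T.pairing_transfer]
    exact hf.nonneg _ fun x => hψ (T x)
  deriv_le φ φ' h := by
    rw [T.pairing_transfer, T.pairing_transfer]
    have hg := (T.isCircleDeriv_koopman h).mul T.isCircleDeriv_invDeriv
    have hdec : T.koopman φ' = (T.koopman φ' * T.circleDeriv * T.invDeriv
        + T.koopman φ * T.distortion) - T.koopman φ * T.distortion := by
      ext x
      have : T.circleDeriv x * T.invDeriv x = 1 := mul_inv_cancel₀ (T.circleDeriv_ne_zero x)
      simp [mul_assoc, this]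
    have h1 := hf.deriv_le _ _ hg
    have h2 : pairing f |T.koopman φ * T.invDeriv| ≤ pairing f ((1 / lam) • T.koopman |φ|) := by
      refine pairing_mono_of_nonneg hf.nonneg fun x => ?_
      change |φ (T x) * T.invDeriv x| ≤ 1 / lam * |φ (T x)|
      rw [abs_mul, mul_comm]
      exact mul_le_mul_of_nonneg_right (hT.abs_invDeriv_le x) (abs_nonneg _)
    have h3 : |pairing f (T.koopman φ * T.distortion)| ≤ pairing f (B • T.koopman |φ|) := by
      refine abs_pairing_le_of_nonneg hf.nonneg fun x => ?_
      change |φ (T x) * T.distortion x| ≤ B * |φ (T x)|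
      rw [abs_mul, mul_comm]
      exact mul_le_mul_of_nonneg_right (hT.abs_distortion_le x) (abs_nonneg _)
    rw [map_smul, smul_eq_mul] at h2 h3
    rw [hdec, map_sub]
    refine (abs_sub _ _).trans ((add_le_add (h1.trans (mul_le_mul_of_nonneg_left h2 ha)) h3).trans_eq ?_)
    ring

/-! ### Lower bound for densities in the cone -/

theorem integral_circle_eq (ψ : C(UnitAddCircle, ℝ)) (x : ℝ) :
    ∫ y in x..x + 1, ψ (y : UnitAddCircle) = ∫ y, ψ y :=
  UnitAddCircle.intervalIntegral_preimage x ψ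

/-- The periodic solution of `φ' = a φ - (1 - exp (-a)) ψ`. -/
def expAverage (a : ℝ) (ψ : C(UnitAddCircle, ℝ)) (x : ℝ) : ℝ :=
  Real.exp (a * x) * ∫ y in x..x + 1, Real.exp (-(a * y)) * ψ (y : UnitAddCircle)

theorem continuous_comp_coe (ψ : C(UnitAddCircle, ℝ)) :
    Continuous fun y : ℝ => ψ (y : UnitAddCircle) :=
  ψ.continuous.comp (AddCircle.continuous_mk' 1)

theorem periodic_expAverage (a : ℝ) (ψ : C(UnitAddCircle, ℝ)) :
    Function.Periodic (expAverage a ψ) 1 := fun x => by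
  have h := intervalIntegral.integral_comp_add_right (a := x) (b := x + 1)
    (fun y => Real.exp (-(a * y)) * ψ (y : UnitAddCircle)) 1
  have e : ∀ y : ℝ, Real.exp (-(a * (y + 1))) * ψ ((y + 1 : ℝ) : UnitAddCircle)
      = Real.exp (-a) * (Real.exp (-(a * y)) * ψ (y : UnitAddCircle)) := fun y => by
    rw [coe_add_one, ← mul_assoc, ← Real.exp_add]
    ring_nf
  simp only [e, intervalIntegral.integral_const_mul] at h
  rw [expAverage, ← h, ← mul_assoc, ← Real.exp_add, expAverage]
  ring_nf

theorem hasDerivAt_expAverage (a : ℝ) (ψ : C(UnitAddCircle, ℝ)) (x : ℝ) :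
    HasDerivAt (expAverage a ψ)
      (a * expAverage a ψ x - (1 - Real.exp (-a)) * ψ (x : UnitAddCircle)) x := by
  have hc : Continuous fun y : ℝ => Real.exp (-(a * y)) * ψ (y : UnitAddCircle) :=
    (by fun_prop : Continuous fun y : ℝ => Real.exp (-(a * y))).mul (continuous_comp_coe ψ)
  set k : ℝ → ℝ := fun y => Real.exp (-(a * y)) * ψ (y : UnitAddCircle) with hk
  have hQ : ∀ z, HasDerivAt (fun u => ∫ y in (0 : ℝ)..u, k y) (k z) z := fun z =>
    hc.integral_hasStrictDerivAt 0 z |>.hasDerivAt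
  have hsplit : (fun u => ∫ y in u..u + 1, k y)
      = fun u => (∫ y in (0 : ℝ)..u + 1, k y) - ∫ y in (0 : ℝ)..u, k y := by
    funext u
    rw [intervalIntegral.integral_interval_sub_left (hc.intervalIntegrable _ _)
      (hc.intervalIntegrable _ _)]
  have hI : HasDerivAt (fun u => ∫ y in u..u + 1, k y) (k (x + 1) - k x) x := by
    rw [hsplit]
    exact ((hQ (x + 1)).comp_add_const x 1).sub (hQ x)
  have hE : HasDerivAt (fun u => Real.exp (a * u)) (Real.exp (a * x) * a) x := by
    simpa using ((hasDerivAt_id x).const_mul a).exp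
  have := hE.mul hI
  refine HasDerivAt.congr_deriv (f := expAverage a ψ) this ?_
  have e1 : Real.exp (a * x) * Real.exp (-(a * x)) = 1 := by rw [← Real.exp_add]; simp
  have e2 : Real.exp (a * x) * Real.exp (-(a * (x + 1))) = Real.exp (-a) := by
    rw [← Real.exp_add]; ring_nf
  simp only [hk, coe_add_one, expAverage]
  linear_combination ψ (x : UnitAddCircle) * e2 - ψ (x : UnitAddCircle) * e1

theorem exp_mul_integral_le_expAverage {a : ℝ} (ha : 0 ≤ a) {ψ : C(UnitAddCircle, ℝ)}
    (hψ : 0 ≤ ψ) (x : ℝ) : Real.exp (-a) * ∫ y, ψ y ≤ expAverage a ψ x := by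
  have hc : Continuous fun y : ℝ => Real.exp (-(a * y)) * ψ (y : UnitAddCircle) :=
    (by fun_prop : Continuous fun y : ℝ => Real.exp (-(a * y))).mul (continuous_comp_coe ψ)
  rw [expAverage, ← integral_circle_eq ψ x, ← intervalIntegral.integral_const_mul,
    ← intervalIntegral.integral_const_mul]
  refine intervalIntegral.integral_mono_on (by linarith)
    ((continuous_comp_coe ψ).const_mul _ |>.intervalIntegrable _ _)
    (hc.const_mul _ |>.intervalIntegrable _ _) fun y hy => ?_
  rw [← mul_assoc, ← Real.exp_add]
  refine mul_le_mul_of_nonneg_right (Real.exp_le_exp.2 ?_) (hψ _)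
  nlinarith [hy.2]

/-- The cone inequality is tested on `φ - m`, where `φ` solves `φ' = a φ - (1 - exp (-a)) ψ` and `m
= exp (-a) ∫ ψ` is a lower bound for `φ`. The absolute value then disappears, the terms in `φ`
cancel, and `a m ≤ (1 - exp (-a)) ∫ f ψ` remains. -/
theorem LogLipschitz.le_pairing {a : ℝ} (ha : 0 ≤ a) {f : CircleL1} (hf : LogLipschitz a f)
    (h1 : pairing f 1 = 1) {ψ : C(UnitAddCircle, ℝ)} (hψ : 0 ≤ ψ) :
    a * Real.exp (-a) * ∫ x, ψ x ≤ pairing f ψ := by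
  set m := Real.exp (-a) * ∫ x, ψ x with hm
  have hcont : Continuous (expAverage a ψ) :=
    continuous_iff_continuousAt.2 fun x => (hasDerivAt_expAverage a ψ x).continuousAt
  set φ := circleMapOfPeriodic _ (periodic_expAverage a ψ) hcont with hφ
  have hd : IsCircleDeriv φ (a • φ - (1 - Real.exp (-a)) • ψ) := hasDerivAt_expAverage a ψ
  have hle : ∀ x, m ≤ φ x := circle_forall.2 (exp_mul_integral_le_expAverage ha hψ)
  have key := (le_abs_self _).trans (hf.deriv_le _ _ (hd.sub_const m))
  have habs : |φ - ContinuousMap.const _ m| = φ - m • (1 : C(UnitAddCircle, ℝ)) := by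
    ext x
    have := hle x
    simp [abs_of_nonneg, this]
  rw [habs] at key
  simp only [map_sub, map_smul, smul_eq_mul, h1] at key
  have := hf.nonneg ψ hψ
  nlinarith [mul_nonneg (Real.exp_pos (-a)).le this]

namespace LogLipschitz

theorem norm_eq_one {a : ℝ} {f : CircleL1} (hf : LogLipschitz a f) (h1 : pairing f 1 = 1) :
    ‖f‖ = 1 := by
  rw [norm_eq_pairing_one hf.nonneg, h1]

theorem of_tendsto {a : ℝ} {f : ℕ → CircleL1} {g : CircleL1} (hf : ∀ n, LogLipschitz a (f n))
    (h : Tendsto f atTop (𝓝 g)) : LogLipschitz a g where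
  nonneg ψ hψ := ge_of_tendsto' (((continuous_pairing ψ).tendsto g).comp h)
    fun n => (hf n).nonneg ψ hψ
  deriv_le φ φ' hφ := le_of_tendsto_of_tendsto'
    (((continuous_pairing φ').tendsto g).comp h).abs
    ((((continuous_pairing |φ|).tendsto g).comp h).const_mul a)
    fun n => (hf n).deriv_le φ φ' hφ

end LogLipschitz

/-! ### Coupling, geometric contraction and existence of a fixed density -/

/-- The proportion of mass coupled with the uniform density at each iteration. -/
def couplingRate (lam B a : ℝ) : ℝ :=
  (1 - (a / lam + B) / a) * ((a / lam + B) * Real.exp (-(a / lam + B)))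

namespace ExpandingCircleMap

variable {T : ExpandingCircleMap} {lam B a : ℝ}

theorem HasBounds.rate_pos (hT : T.HasBounds lam B) (ha : 0 < a) : 0 < a / lam + B :=
  add_pos_of_pos_of_nonneg (div_pos ha (by linarith [hT.one_lt])) hT.nonneg

theorem HasBounds.couplingRate_pos (hT : T.HasBounds lam B) (ha : 0 < a)
    (hlt : a / lam + B < a) : 0 < couplingRate lam B a :=
  mul_pos (sub_pos.2 ((div_lt_one ha).2 hlt)) (mul_pos (hT.rate_pos ha) (Real.exp_pos _))

theorem mul_exp_neg_lt_one (t : ℝ) : t * Real.exp (-t) < 1 := by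
  have h : t < Real.exp t := by linarith [Real.add_one_le_exp t]
  rwa [Real.exp_neg, ← div_eq_mul_inv, div_lt_one (Real.exp_pos _)]

theorem HasBounds.couplingRate_le (hT : T.HasBounds lam B) (ha : 0 < a) :
    couplingRate lam B a ≤ (a / lam + B) * Real.exp (-(a / lam + B)) := by
  have h := hT.rate_pos ha
  refine mul_le_of_le_one_left (mul_pos h (Real.exp_pos _)).le ?_
  linarith [div_pos h ha]

theorem HasBounds.couplingRate_lt_one (hT : T.HasBounds lam B) (ha : 0 < a) :
    couplingRate lam B a < 1 :=
  (hT.couplingRate_le ha).trans_lt (mul_exp_neg_lt_one _)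

theorem pairing_transfer_one (T : ExpandingCircleMap) (f : CircleL1) :
    pairing (T.transfer f) 1 = pairing f 1 := by
  rw [pairing_transfer]
  rfl

/-- Put `ρ = a / lam + B`. The image of `f` lies in the cone of `ρ`, so it dominates `ρ exp (-ρ)`
times the uniform density. Removing `κ` times that density leaves the derivative pairings unchanged,
so the remainder is in the cone of `a` as soon as `a κ ∫ |φ|` is at most `a - ρ` times the pairing
of the image with `|φ|`. This dictates `κ = (1 - ρ / a) ρ exp (-ρ)`. -/
theorem HasBounds.exists_coupling (hT : T.HasBounds lam B) (ha : 0 < a)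
    (hlt : a / lam + B < a) {f : CircleL1} (hf : LogLipschitz a f) (h1 : pairing f 1 = 1) :
    ∃ g, LogLipschitz a g ∧ pairing g 1 = 1 ∧ T.transfer f =
      couplingRate lam B a • uniformDensity + (1 - couplingRate lam B a) • g := by
  set κ := couplingRate lam B a with hκ
  have hκ1 : 0 < 1 - κ := sub_pos.2 (hT.couplingRate_lt_one ha)
  have hP := hT.logLipschitz_transfer ha.le hf
  have hP1 := (T.pairing_transfer_one f).trans h1
  have hpos := hT.rate_pos ha
  have hlow := fun {ψ : C(UnitAddCircle, ℝ)} (hψ : 0 ≤ ψ) => hP.le_pairing hpos.le hP1 hψ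
  have hbase : LogLipschitz a (T.transfer f - κ • uniformDensity) := by
    constructor
    · intro ψ hψ
      have hi : 0 ≤ ∫ x, ψ x := integral_nonneg hψ
      simp only [map_sub, map_smul, LinearMap.sub_apply, LinearMap.smul_apply, smul_eq_mul,
        pairing_uniformDensity, sub_nonneg]
      exact (mul_le_mul_of_nonneg_right (hT.couplingRate_le ha) hi).trans (hlow hψ)
    · intro φ φ' h
      have h2 := hlow (abs_nonneg φ)
      simp only [map_sub, map_smul, LinearMap.sub_apply, LinearMap.smul_apply, smul_eq_mul,
        pairing_uniformDensity, h.integral_eq_zero, mul_zero, sub_zero]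
      refine (hP.deriv_le φ φ' h).trans ?_
      have h3 : a * κ = (a - (a / lam + B))
          * ((a / lam + B) * Real.exp (-(a / lam + B))) := by
        rw [hκ, couplingRate]
        field_simp
      have h4 := mul_le_mul_of_nonneg_left h2 (sub_pos.2 hlt).le
      rw [← mul_assoc, ← h3] at h4
      linarith
  refine ⟨(1 - κ)⁻¹ • (T.transfer f - κ • uniformDensity),
    hbase.smul (inv_pos.2 hκ1).le, ?_, ?_⟩
  · simp only [map_sub, map_smul, LinearMap.sub_apply, LinearMap.smul_apply, smul_eq_mul,
      pairing_uniformDensity_one, hP1, mul_one]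
    exact inv_mul_cancel₀ hκ1.ne'
  · rw [smul_inv_smul₀ hκ1.ne']
    abel

/-- The uniform parts of the two images cancel, leaving `1 - κ` times a difference of the same kind.
-/
theorem HasBounds.norm_pow_transfer_sub_le (hT : T.HasBounds lam B) (ha : 0 < a)
    (hlt : a / lam + B < a) (n : ℕ) : ∀ {f g : CircleL1}, LogLipschitz a f → pairing f 1 = 1 →
      LogLipschitz a g → pairing g 1 = 1 →
      ‖(T.transfer ^ n) (f - g)‖ ≤ 2 * (1 - couplingRate lam B a) ^ n := by
  induction n with
  | zero =>
    intro f g hf hf1 hg hg1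
    have := norm_sub_le f g
    rw [hf.norm_eq_one hf1, hg.norm_eq_one hg1] at this
    simp only [pow_zero, one_apply_eq_self, mul_one]
    linarith
  | succ n ih =>
    intro f g hf hf1 hg hg1
    obtain ⟨f', hf', hf1', ef⟩ := hT.exists_coupling ha hlt hf hf1
    obtain ⟨g', hg', hg1', eg⟩ := hT.exists_coupling ha hlt hg hg1
    have hκ := hT.couplingRate_lt_one ha
    rw [pow_succ, mul_apply_eq_comp, map_sub, ef, eg, add_sub_add_left_eq_sub,
      ← smul_sub, map_smul, norm_smul, Real.norm_of_nonneg (by linarith), pow_succ]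
    nlinarith [ih hf' hf1' hg' hg1']

theorem HasBounds.logLipschitz_pow_transfer (hT : T.HasBounds lam B) (ha : 0 < a)
    (hlt : a / lam + B < a) {f : CircleL1} (hf : LogLipschitz a f) (n : ℕ) :
    LogLipschitz a ((T.transfer ^ n) f) := by
  induction n with
  | zero => simpa using hf
  | succ n ih =>
    rw [pow_succ', mul_apply_eq_comp]
    exact (hT.logLipschitz_transfer ha.le ih).mono hlt.le

theorem pairing_pow_transfer_one (T : ExpandingCircleMap) (f : CircleL1) (n : ℕ) :
    pairing ((T.transfer ^ n) f) 1 = pairing f 1 := by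
  induction n with
  | zero => simp
  | succ n ih => rw [pow_succ', mul_apply_eq_comp, pairing_transfer_one, ih]

theorem norm_pow_transfer_le (T : ExpandingCircleMap) (f : CircleL1) (n : ℕ) :
    ‖(T.transfer ^ n) f‖ ≤ ‖f‖ := by
  induction n with
  | zero => simp
  | succ n ih =>
    rw [pow_succ', mul_apply_eq_comp]
    exact (T.norm_transfer_le _).trans ih

theorem pow_transfer_eq_self {f : CircleL1} (hf : T.transfer f = f) (n : ℕ) :
    (T.transfer ^ n) f = f := by
  induction n with
  | zero => simp
  | succ n ih => rw [pow_succ, mul_apply_eq_comp, hf, ih]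

theorem HasBounds.exists_fixed (hT : T.HasBounds lam B) (ha : 0 < a)
    (hlt : a / lam + B < a) :
    ∃ h, LogLipschitz a h ∧ pairing h 1 = 1 ∧ T.transfer h = h := by
  have hu := logLipschitz_uniformDensity ha.le
  have hu1 := pairing_uniformDensity_one
  have hκ0 := hT.couplingRate_pos ha hlt
  have hκ1 := hT.couplingRate_lt_one ha
  have hcau : CauchySeq fun n => (T.transfer ^ n) uniformDensity := by
    refine cauchySeq_of_le_geometric (1 - couplingRate lam B a) 2 (by linarith) fun n => ?_
    rw [dist_eq_norm, pow_succ, mul_apply_eq_comp, ← map_sub]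
    exact hT.norm_pow_transfer_sub_le ha hlt n hu hu1
      ((hT.logLipschitz_transfer ha.le hu).mono hlt.le) ((T.pairing_transfer_one _).trans hu1)
  obtain ⟨h, hh⟩ := cauchySeq_tendsto_of_complete hcau
  refine ⟨h, LogLipschitz.of_tendsto (hT.logLipschitz_pow_transfer ha hlt hu) hh, ?_, ?_⟩
  · refine tendsto_nhds_unique (((continuous_pairing 1).tendsto h).comp hh) ?_
    simp only [Function.comp_def, pairing_pow_transfer_one, hu1]
    exact tendsto_const_nhds
  · refine tendsto_nhds_unique ((T.transfer.continuous.tendsto h).comp hh) ?_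
    have := (tendsto_add_atTop_iff_nat 1).2 hh
    simpa only [pow_succ', mul_apply_eq_comp, Function.comp_def] using this

end ExpandingCircleMap

/-! ### Convergence of all densities and uniqueness -/

theorem pairing_toLp (φ ψ : C(UnitAddCircle, ℝ)) :
    pairing (ContinuousMap.toLp 1 volume ℝ φ) ψ = ∫ x, φ x * ψ x := by
  rw [pairing_apply]
  refine integral_congr_ae ?_
  filter_upwards [ContinuousMap.coeFn_toLp (p := 1) (𝕜 := ℝ) volume φ] with x hx
  rw [hx]

theorem integrable_continuousMap (ψ : C(UnitAddCircle, ℝ)) :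
    Integrable (fun x => ψ x) volume := by
  simpa using integrable_mul_continuousMap (integrable_const (1 : ℝ)) ψ

/-- Integration by parts moves the derivative onto `φ`, and `|φ'| ≤ a ≤ a φ` because `φ ≥ 1`. -/
theorem IsCircleDeriv.logLipschitz_toLp {φ φ' : C(UnitAddCircle, ℝ)} (h : IsCircleDeriv φ φ')
    (h1 : ∀ x, 1 ≤ φ x) {a : ℝ} (ha : ∀ x, |φ' x| ≤ a) :
    LogLipschitz a (ContinuousMap.toLp 1 volume ℝ φ) where
  nonneg ψ hψ := by
    rw [pairing_toLp]
    exact integral_nonneg fun x => mul_nonneg (by linarith [h1 x]) (hψ x)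
  deriv_le χ χ' hχ := by
    have hz := (h.mul hχ).integral_eq_zero
    have e : pairing (ContinuousMap.toLp 1 volume ℝ φ) χ' = ∫ x, -(φ' * χ) x := by
      have hadd := integral_add (integrable_continuousMap (φ' * χ))
        (integrable_continuousMap (φ * χ'))
      rw [pairing_toLp, integral_neg, eq_neg_iff_add_eq_zero, ← hz, add_comm]
      exact hadd.symm
    rw [e, pairing_toLp, ← integral_const_mul]
    refine abs_integral_le_integral_abs.trans (integral_mono
      (integrable_continuousMap (φ' * χ)).neg.abs
      ((integrable_continuousMap (φ * |χ|)).const_mul a) fun x => ?_)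
    simp only [abs_neg, ContinuousMap.mul_apply, abs_mul, ContinuousMap.abs_apply]
    rw [← mul_assoc]
    refine mul_le_mul_of_nonneg_right ?_ (abs_nonneg _)
    nlinarith [ha x, h1 x, abs_nonneg (φ' x)]

/-- The algebra of continuously differentiable functions on the circle. -/
def circleC1 : Subalgebra ℝ C(UnitAddCircle, ℝ) where
  carrier := {φ | ∃ φ', IsCircleDeriv φ φ'}
  mul_mem' := fun ⟨_, h⟩ ⟨_, k⟩ => ⟨_, h.mul k⟩
  add_mem' := fun ⟨_, h⟩ ⟨_, k⟩ => ⟨_, h.add k⟩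
  algebraMap_mem' := fun c => ⟨0, IsCircleDeriv.const c⟩

theorem circleC1_separatesPoints : circleC1.SeparatesPoints := by
  have hcos : Continuous fun x : ℝ => Real.cos (2 * Real.pi * x) := by fun_prop
  have hsin : Continuous fun x : ℝ => Real.sin (2 * Real.pi * x) := by fun_prop
  have pcos : Function.Periodic (fun x : ℝ => Real.cos (2 * Real.pi * x)) 1 := fun x => by
    simp only [mul_add, mul_one, Real.cos_add_two_pi]
  have psin : Function.Periodic (fun x : ℝ => Real.sin (2 * Real.pi * x)) 1 := fun x => by
    simp only [mul_add, mul_one, Real.sin_add_two_pi]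
  set c := circleMapOfPeriodic _ pcos hcos
  set s := circleMapOfPeriodic _ psin hsin
  have hl : ∀ x : ℝ, HasDerivAt (fun y : ℝ => 2 * Real.pi * y) (2 * Real.pi) x := fun x => by
    simpa using (hasDerivAt_id x).const_mul (2 * Real.pi)
  have hc : c ∈ circleC1 := ⟨-((2 * Real.pi) • s), fun x => by
    refine HasDerivAt.congr_deriv (hl x).cos ?_
    change _ = -(2 * Real.pi * Real.sin (2 * Real.pi * x))
    ring⟩
  have hs : s ∈ circleC1 := ⟨(2 * Real.pi) • c, fun x => by
    refine HasDerivAt.congr_deriv (hl x).sin ?_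
    change _ = 2 * Real.pi * Real.cos (2 * Real.pi * x)
    ring⟩
  intro x y hxy
  by_contra! hne
  apply hxy
  have h1 := hne c ⟨c, hc, rfl⟩
  have h2 := hne s ⟨s, hs, rfl⟩
  revert h1 h2
  refine QuotientAddGroup.induction_on x fun x => QuotientAddGroup.induction_on y fun y => ?_
  intro h1 h2
  have h3 := Real.Angle.cos_sin_inj (θ := 2 * Real.pi * x) (ψ := 2 * Real.pi * y) h1 h2
  obtain ⟨k, hk⟩ := Real.Angle.angle_eq_iff_two_pi_dvd_sub.1 h3
  refine coe_unitAddCircle_eq_iff.2 ⟨k, ?_⟩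
  have hpi : (2 * Real.pi) ≠ 0 := by positivity
  have : 2 * Real.pi * (x - (y + k)) = 0 := by linarith
  linarith [(mul_eq_zero.1 this).resolve_left hpi]

namespace ExpandingCircleMap

variable {T : ExpandingCircleMap} {lam B a : ℝ}

theorem HasBounds.tendsto_pow_transfer_of_mem_circleC1 (hT : T.HasBounds lam B) (ha : 0 < a)
    (hlt : a / lam + B < a) {h : CircleL1} (hh : LogLipschitz a h) (hh1 : pairing h 1 = 1)
    (hfix : T.transfer h = h) {φ : C(UnitAddCircle, ℝ)} (hφ : φ ∈ circleC1) :
    Tendsto (fun n => (T.transfer ^ n) (ContinuousMap.toLp 1 volume ℝ φ)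
      - pairing (ContinuousMap.toLp 1 volume ℝ φ) 1 • h) atTop (𝓝 0) := by
  obtain ⟨φ', hφ'⟩ := hφ
  set F := (ContinuousMap.toLp 1 (volume : Measure UnitAddCircle) ℝ :
    C(UnitAddCircle, ℝ) →L[ℝ] CircleL1) with hF
  -- The cone is enlarged to accommodate `φ'`; it is still mapped strictly inside itself, since `b -
  -- b / lam` is at least `a - a / lam`.
  set b := max a ‖φ'‖ with hb
  have hab : a ≤ b := le_max_left _ _
  have hb0 : 0 < b := ha.trans_le hab
  have hl0 : 0 < lam := by linarith [hT.one_lt]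
  have hbl : b / lam + B < b := by
    have h1 : b / lam - a / lam ≤ b - a := by
      rw [← sub_div]
      exact div_le_self (by linarith) hT.one_lt.le
    linarith
  have main : ∀ χ χ', IsCircleDeriv χ χ' → (∀ x, 1 ≤ χ x) → (∀ x, |χ' x| ≤ b) →
      Tendsto (fun n => (T.transfer ^ n) (F χ) - pairing (F χ) 1 • h) atTop (𝓝 0) := by
    intro χ χ' hχ h1 hle
    have hlog : LogLipschitz b (F χ) := hχ.logLipschitz_toLp h1 hle
    have hc : 0 < pairing (F χ) 1 := by
      have : ∫ x : UnitAddCircle, (1 : ℝ) ≤ ∫ x, χ x * (1 : C(UnitAddCircle, ℝ)) x :=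
        integral_mono (integrable_const _) (integrable_continuousMap (χ * 1)) fun x => by
          simpa using h1 x
      rw [← pairing_toLp] at this
      simp [measureReal_def] at this
      linarith
    set c := pairing (F χ) 1 with hcdef
    rw [tendsto_zero_iff_norm_tendsto_zero]
    have hκ0 := hT.couplingRate_pos hb0 hbl
    have hκ1 := hT.couplingRate_lt_one hb0
    have hgeo : Tendsto (fun n => c * (2 * (1 - couplingRate lam B b) ^ n)) atTop (𝓝 0) := by
      have := (tendsto_pow_atTop_nhds_zero_of_lt_one (r := 1 - couplingRate lam B b)
        (by linarith) (by linarith)).const_mul 2 |>.const_mul c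
      simpa using this
    refine squeeze_zero (fun _ => norm_nonneg _) (fun n => ?_) hgeo
    have e : (T.transfer ^ n) (F χ) - c • h = c • (T.transfer ^ n) (c⁻¹ • F χ - h) := by
      rw [map_sub, map_smul, pow_transfer_eq_self hfix, smul_sub, smul_inv_smul₀ hc.ne']
    rw [e, norm_smul, Real.norm_of_nonneg hc.le]
    refine mul_le_mul_of_nonneg_left (hT.norm_pow_transfer_sub_le hb0 hbl n
      (hlog.smul (inv_pos.2 hc).le) ?_ (hh.mono hab) hh1) hc.le
    rw [map_smul, LinearMap.smul_apply, smul_eq_mul, ← hcdef, inv_mul_cancel₀ hc.ne']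
  have hone := main 1 0 (IsCircleDeriv.const 1) (fun x => le_rfl) fun x => by simpa using hb0.le
  -- Adding `M` makes `φ` at least one; the constant is removed afterwards by linearity.
  set M := ‖φ‖ + 1 with hM
  have hφM := main (φ + ContinuousMap.const _ M) (φ' + 0) (hφ'.add (IsCircleDeriv.const M))
    (fun x => by
      have := neg_le_of_abs_le (φ.norm_coe_le_norm x)
      simp only [ContinuousMap.add_apply, ContinuousMap.const_apply]
      linarith)
    (fun x => by
      rw [add_zero]
      exact (φ'.norm_coe_le_norm x).trans (le_max_right a _))
  have hconst : ContinuousMap.const UnitAddCircle M = M • (1 : C(UnitAddCircle, ℝ)) := by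
    ext x; simp
  have := hφM.sub (hone.const_smul M)
  rw [smul_zero, sub_zero] at this
  refine this.congr fun n => ?_
  simp only [hconst, map_add, map_smul, LinearMap.add_apply, LinearMap.smul_apply, smul_eq_mul,
    add_smul, smul_sub, mul_smul]
  abel

/-- Iterates do not increase the `L¹` norm, so the set of `f` with this convergence is closed. It
contains the `C¹` functions, which are dense by Stone–Weierstrass. -/
theorem HasBounds.tendsto_pow_transfer (hT : T.HasBounds lam B) (ha : 0 < a)
    (hlt : a / lam + B < a) {h : CircleL1} (hh : LogLipschitz a h) (hh1 : pairing h 1 = 1)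
    (hfix : T.transfer h = h) (f : CircleL1) :
    Tendsto (fun n => (T.transfer ^ n) f - pairing f 1 • h) atTop (𝓝 0) := by
  have hclosed : IsClosed {f : CircleL1 |
      Tendsto (fun n => (T.transfer ^ n) f - pairing f 1 • h) atTop (𝓝 0)} := by
    refine isClosed_of_closure_subset fun f hf => ?_
    rw [Metric.mem_closure_iff] at hf
    rw [Set.mem_ofPred_eq, Metric.tendsto_atTop]
    intro ε hε
    obtain ⟨g, hg, hfg⟩ := hf (ε / 4) (by positivity)
    obtain ⟨N, hN⟩ := Metric.tendsto_atTop.1 hg (ε / 4) (by positivity)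
    refine ⟨N, fun n hn => ?_⟩
    have h1 := hN n hn
    rw [dist_zero_right] at h1 ⊢
    rw [dist_eq_norm] at hfg
    have e : (T.transfer ^ n) f - pairing f 1 • h = (T.transfer ^ n) (f - g)
        + ((T.transfer ^ n) g - pairing g 1 • h) - pairing (f - g) 1 • h := by
      rw [map_sub, map_sub, LinearMap.sub_apply, sub_smul]
      abel
    have h2 := T.norm_pow_transfer_le (f - g) n
    have h3 : ‖pairing (f - g) 1 • h‖ ≤ ‖f - g‖ := by
      rw [norm_smul, hh.norm_eq_one hh1, mul_one, Real.norm_eq_abs]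
      simpa using abs_pairing_le_of_abs_le (f - g) 1 (c := 1) (by simp)
    rw [e]
    linarith [norm_sub_le ((T.transfer ^ n) (f - g) + ((T.transfer ^ n) g - pairing g 1 • h))
      (pairing (f - g) 1 • h), norm_add_le ((T.transfer ^ n) (f - g))
      ((T.transfer ^ n) g - pairing g 1 • h)]
  refine (ContinuousMap.toLp_denseRange ℝ (volume : Measure UnitAddCircle) ℝ
    (p := 1) ENNReal.one_ne_top).induction_on f hclosed fun φ => ?_
  have hd : φ ∈ closure (circleC1 : Set C(UnitAddCircle, ℝ)) := by
    rw [← Subalgebra.topologicalClosure_coe,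
      ContinuousMap.subalgebra_topologicalClosure_eq_top_of_separatesPoints _
        circleC1_separatesPoints]
    trivial
  exact closure_minimal (fun χ hχ =>
    hT.tendsto_pow_transfer_of_mem_circleC1 ha hlt hh hh1 hfix hχ)
    (hclosed.preimage (ContinuousMap.toLp 1 volume ℝ).continuous) hd

theorem HasBounds.eq_of_fixed (hT : T.HasBounds lam B) (ha : 0 < a)
    (hlt : a / lam + B < a) {h : CircleL1} (hh : LogLipschitz a h) (hh1 : pairing h 1 = 1)
    (hfix : T.transfer h = h) {f : CircleL1} (hf1 : pairing f 1 = 1) (hf : T.transfer f = f) :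
    f = h := by
  have := hT.tendsto_pow_transfer ha hlt hh hh1 hfix f
  simp only [pow_transfer_eq_self hf, hf1, one_smul] at this
  exact sub_eq_zero.1 (tendsto_nhds_unique tendsto_const_nhds this)

end ExpandingCircleMap

/-! ### Comparison of the transfer operators of two close maps -/

theorem intervalIntegral_add_intCast (ψ : C(UnitAddCircle, ℝ)) (a b : ℝ) (d : ℤ) :
    ∫ y in a + d..b + d, ψ (y : UnitAddCircle) = ∫ y in a..b, ψ (y : UnitAddCircle) := by
  rw [← intervalIntegral.integral_comp_add_right (fun y : ℝ => ψ (y : UnitAddCircle))]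
  refine intervalIntegral.integral_congr fun y _ => congrArg ψ ?_
  exact coe_unitAddCircle_eq_iff.2 ⟨d, rfl⟩

namespace ExpandingCircleMap

theorem exists_int_lift_sub_lift_le {T S : ExpandingCircleMap} {ε : ℝ} (hε : ε < 1 / 2)
    (h0 : ∀ x : UnitAddCircle, ‖T x - S x‖ ≤ ε) :
    ∃ n : ℤ, ∀ x, |T.lift x - S.lift x - n| ≤ ε := by
  have hT := T.contDiff_lift.continuous
  have hS := S.contDiff_lift.continuous
  refine exists_int_of_forall_near_int (by fun_prop) hε fun x => ?_
  have := h0 x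
  rw [T.coe_lift, S.coe_lift, ← AddCircle.coe_sub, UnitAddCircle.norm_eq] at this
  exact ⟨_, this⟩

/-- The primitive of `ψ` integrated between the two perturbed images of a point has derivative
`(ψ ∘ T) T' - (ψ ∘ S) S'` and is small when `T` and `S` are close. -/
theorem exists_isCircleDeriv_koopman_sub {T S : ExpandingCircleMap} {ε : ℝ} (hε : ε ≤ 1 / 4)
    (h0 : ∀ x : UnitAddCircle, ‖T x - S x‖ ≤ ε) {ψ : C(UnitAddCircle, ℝ)}
    (hψ : ∀ x, |ψ x| ≤ 1) :
    ∃ H, IsCircleDeriv H (T.koopman ψ * T.circleDeriv - S.koopman ψ * S.circleDeriv) ∧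
      ∀ x, |H x| ≤ ε := by
  obtain ⟨n, hn⟩ := exists_int_lift_sub_lift_le (by linarith) h0
  obtain ⟨d, hd⟩ := T.exists_degree
  obtain ⟨d', hd'⟩ := S.exists_degree
  -- The difference of the lifts stays within `1 / 4` of `n` at both `0` and `1`, so the degrees
  -- differ by less than one. Equal degrees make `G` below periodic.
  obtain rfl : d = d' := by
    have e1 := abs_le.1 (hn 0)
    have e2 := abs_le.1 (hn (0 + 1))
    rw [hd, hd'] at e2
    have h1 : ((d - d' : ℤ) : ℝ) < 1 := by push_cast; linarith
    have h2 : (-1 : ℝ) < ((d - d' : ℤ) : ℝ) := by push_cast; linarith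
    have h3 : d - d' < 1 := by exact_mod_cast h1
    have h4 : -1 < d - d' := by exact_mod_cast h2
    omega
  have hc := continuous_comp_coe ψ
  -- The shift by `n` aligns the lifts, so that the interval of integration has length at most `ε`.
  set G : ℝ → ℝ := fun x => ∫ y in S.lift x + n..T.lift x, ψ (y : UnitAddCircle) with hG
  have hper : Function.Periodic G 1 := fun x => by
    simp only [hG, hd, hd', add_right_comm _ (d : ℝ), intervalIntegral_add_intCast]
  have hQ : ∀ z : ℝ, HasDerivAt (fun u => ∫ y in (0 : ℝ)..u, ψ (y : UnitAddCircle))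
      (ψ (z : UnitAddCircle)) z := fun z : ℝ => (hc.integral_hasStrictDerivAt 0 z).hasDerivAt
  have hderiv : ∀ x : ℝ, HasDerivAt G ((T.koopman ψ * T.circleDeriv
      - S.koopman ψ * S.circleDeriv) (x : UnitAddCircle)) x := fun x => by
    have e : G = fun x => (∫ y in (0 : ℝ)..T.lift x, ψ (y : UnitAddCircle))
        - ∫ y in (0 : ℝ)..S.lift x + n, ψ (y : UnitAddCircle) := by
      funext x
      rw [intervalIntegral.integral_interval_sub_left (hc.intervalIntegrable _ _)
        (hc.intervalIntegrable _ _)]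
    have hTd := (hQ (T.lift x)).comp x (T.hasDerivAt_lift x)
    have hSd := (hQ (S.lift x + n)).comp x ((S.hasDerivAt_lift x).add_const (n : ℝ))
    rw [e]
    refine (hTd.sub hSd).congr_deriv ?_
    have : ((S.lift x + n : ℝ) : UnitAddCircle) = S.lift x :=
      coe_unitAddCircle_eq_iff.2 ⟨n, rfl⟩
    simp [T.coe_lift, S.coe_lift, this]
  refine ⟨circleMapOfPeriodic G hper (continuous_iff_continuousAt.2 fun x =>
    (hderiv x).continuousAt), hderiv, circle_forall.2 fun x => ?_⟩
  rw [circleMapOfPeriodic_coe]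
  have := intervalIntegral.norm_integral_le_of_norm_le_const (a := S.lift x + n) (b := T.lift x)
    (f := fun y : ℝ => ψ (y : UnitAddCircle)) (C := 1) fun y _ => hψ y
  refine this.trans ?_
  rw [one_mul, ← sub_sub]
  exact hn x

/-- With `H` the small primitive, `ψ ∘ T - ψ ∘ S` equals `(H / S')'` plus `(ψ ∘ T) (S' - T') / S'`
minus `H (1 / S')'`. The first term is paid for by the variation of `f`, the other two by `ε` and `ε
B` times its norm. No regularity of `ψ` beyond continuity enters. -/
theorem HasBounds.norm_transfer_sub_le {T S : ExpandingCircleMap} {lam B ε V : ℝ}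
    (hS : S.HasBounds lam B) (hε0 : 0 ≤ ε) (hε : ε ≤ 1 / 4)
    (h0 : ∀ x : UnitAddCircle, ‖T x - S x‖ ≤ ε)
    (h1 : ∀ x, |deriv T.lift x - deriv S.lift x| ≤ ε) {f : CircleL1} (hV : HasVariationLE V f)
    (hV0 : 0 ≤ V) : ‖T.transfer f - S.transfer f‖ ≤ ε * ((1 + B) * ‖f‖ + V) := by
  refine norm_le_of_pairing_le fun ψ hψ => ?_
  obtain ⟨H, hH, hHε⟩ := exists_isCircleDeriv_koopman_sub hε h0 hψ
  have hg := hH.mul S.isCircleDeriv_invDeriv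
  set g' := (T.koopman ψ * T.circleDeriv - S.koopman ψ * S.circleDeriv) * S.invDeriv
    + H * S.distortion with hg'
  have hgnorm : ‖H * S.invDeriv‖ ≤ ε := by
    refine (ContinuousMap.norm_le _ hε0).2 fun x => ?_
    rw [ContinuousMap.mul_apply, Real.norm_eq_abs, abs_mul]
    exact (mul_le_of_le_one_right (abs_nonneg _) (hS.abs_invDeriv_le_one x)).trans (hHε x)
  have hrest : ∀ x, |(T.koopman ψ - S.koopman ψ - g') x| ≤ ε * (1 + B) := fun x => by
    have hx : S.circleDeriv x * S.invDeriv x = 1 := mul_inv_cancel₀ (S.circleDeriv_ne_zero x)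
    have e : (T.koopman ψ - S.koopman ψ - g') x
        = ψ (T x) * ((S.circleDeriv x - T.circleDeriv x) * S.invDeriv x)
          - H x * S.distortion x := by
      simp only [hg', ContinuousMap.sub_apply, ContinuousMap.add_apply, ContinuousMap.mul_apply,
        koopman_apply]
      linear_combination (ψ (S x) - ψ (T x)) * hx
    have hd : |S.circleDeriv x - T.circleDeriv x| ≤ ε := by
      refine (circle_forall (p := fun x => |S.circleDeriv x - T.circleDeriv x| ≤ ε)).2
        (fun x => ?_) x
      rw [abs_sub_comm]
      exact h1 x
    have t1 : |ψ (T x) * ((S.circleDeriv x - T.circleDeriv x) * S.invDeriv x)| ≤ ε := by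
      rw [abs_mul, abs_mul]
      exact (mul_le_of_le_one_left (mul_nonneg (abs_nonneg _) (abs_nonneg _)) (hψ _)).trans
        ((mul_le_of_le_one_right (abs_nonneg _) (hS.abs_invDeriv_le_one x)).trans hd)
    have t2 : |H x * S.distortion x| ≤ ε * B := by
      rw [abs_mul]
      exact mul_le_mul (hHε x) (hS.abs_distortion_le x) (abs_nonneg _) hε0
    rw [e]
    linarith [abs_sub (ψ (T x) * ((S.circleDeriv x - T.circleDeriv x) * S.invDeriv x))
      (H x * S.distortion x)]
  have k1 := (le_abs_self _).trans (abs_pairing_le_of_abs_le f _ hrest)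
  have k2 := (le_abs_self _).trans ((hV _ _ hg).trans (mul_le_mul_of_nonneg_left hgnorm hV0))
  simp only [map_sub] at k1
  rw [map_sub, LinearMap.sub_apply, pairing_transfer, pairing_transfer]
  linarith

theorem norm_transfer_sub_le_two (T S : ExpandingCircleMap) (f : CircleL1) :
    ‖T.transfer f - S.transfer f‖ ≤ 2 * ‖f‖ := by
  linarith [norm_sub_le (T.transfer f) (S.transfer f), T.norm_transfer_le f, S.norm_transfer_le f]

end ExpandingCircleMap

/-! ### Sobolev functions have bounded variation in the weak sense -/

namespace HasW11Deriv

variable {f f' : UnitAddCircle → ℝ}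

theorem intervalIntegrable (hf : HasW11Deriv f f') :
    IntervalIntegrable (fun t : ℝ => f' (t : UnitAddCircle)) volume 0 1 := by
  rw [intervalIntegrable_iff_integrableOn_Ioc_of_le zero_le_one]
  have := (UnitAddCircle.measurePreserving_mk 0).integrable_comp_of_integrable hf.1
  rwa [zero_add] at this

theorem absolutelyContinuousOnInterval (hf : HasW11Deriv f f') :
    AbsolutelyContinuousOnInterval (fun x : ℝ => f (x : UnitAddCircle)) 0 1 := by
  have h1 := hf.intervalIntegrable.absolutelyContinuousOnInterval_intervalIntegral
    (c := 0) (by simp)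
  have h2 : AbsolutelyContinuousOnInterval (fun _ : ℝ => f 0) 0 1 :=
    (contDiff_const (n := 1)).contDiffOn.absolutelyContinuousOnInterval
  have e : (fun x : ℝ => f (x : UnitAddCircle))
      = (fun _ : ℝ => f 0) + fun x => ∫ t in (0 : ℝ)..x, f' (t : UnitAddCircle) :=
    funext hf.2
  rw [e]
  exact h2.add h1

theorem continuous (hf : HasW11Deriv f f') : Continuous f := by
  have hper : Function.Periodic (fun t : ℝ => f' (t : UnitAddCircle)) 1 := fun t => by
    simp only [coe_add_one]
  have hi : ∀ a b : ℝ, IntervalIntegrable (fun t : ℝ => f' (t : UnitAddCircle)) volume a b :=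
    fun a b => hper.intervalIntegrable₀ one_ne_zero hf.intervalIntegrable a b
  refine (QuotientAddGroup.isQuotientMap_mk (N := AddSubgroup.zmultiples (1 : ℝ))).continuous_iff.2 ?_
  change Continuous fun x : ℝ => f (x : UnitAddCircle)
  rw [funext hf.2]
  exact continuous_const.add (intervalIntegral.continuous_primitive hi 0)

theorem integrable (hf : HasW11Deriv f f') : Integrable f volume :=
  integrable_continuousMap ⟨f, hf.continuous⟩

theorem ae_deriv_eq (hf : HasW11Deriv f f') :
    ∀ᵐ x : ℝ, x ∈ Set.uIcc (0 : ℝ) 1 →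
      deriv (fun x : ℝ => f (x : UnitAddCircle)) x = f' (x : UnitAddCircle) := by
  filter_upwards [hf.intervalIntegrable.ae_hasDerivAt_integral] with x hx hx'
  have := (hx hx' 0 (by simp)).const_add (f 0)
  rw [← funext hf.2] at this
  exact this.deriv

/-- Integration by parts for absolutely continuous functions on one period, where the boundary terms
cancel. -/
theorem hasVariationLE (hf : HasW11Deriv f f') :
    HasVariationLE (l1Norm f') (hf.integrable.toL1 f) := by
  intro φ φ' hφ
  have hac := hf.absolutelyContinuousOnInterval
  have hφd : ∀ x : ℝ, deriv (fun y : ℝ => φ (y : UnitAddCircle)) x = φ' (x : UnitAddCircle) :=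
    fun x => (hφ x).deriv
  have hφC : ContDiff ℝ 1 fun y : ℝ => φ (y : UnitAddCircle) :=
    contDiff_one_iff_deriv.2 ⟨fun x => (hφ x).differentiableAt, by
      rw [funext hφd]; exact continuous_comp_coe φ'⟩
  have hibp := hac.integral_mul_deriv_eq_deriv_mul
    (hφC.contDiffOn.absolutelyContinuousOnInterval (a := 0) (b := 1))
  have h01 : ((1 : ℝ) : UnitAddCircle) = (0 : ℝ) := by
    simp
  have e1 : ∫ x in (0 : ℝ)..1, deriv (fun x : ℝ => f (x : UnitAddCircle)) x * φ (x : UnitAddCircle)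
      = ∫ x in (0 : ℝ)..1, f' (x : UnitAddCircle) * φ (x : UnitAddCircle) := by
    refine intervalIntegral.integral_congr_ae ?_
    filter_upwards [hf.ae_deriv_eq] with x hx hx'
    rw [hx (Set.uIoc_subset_uIcc hx')]
  have e2 := UnitAddCircle.intervalIntegral_preimage 0 fun x => f x * φ' x
  have e3 := UnitAddCircle.intervalIntegral_preimage 0 fun x => f' x * φ x
  rw [zero_add] at e2 e3
  simp only [hφd, h01, sub_self, zero_sub, e1, e2, e3] at hibp
  rw [pairing_toL1, hibp, abs_neg, ← pairing_toL1 hf.1, mul_comm, ← norm_toL1_eq_l1Norm hf.1]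
  exact abs_pairing_le _ _

end HasW11Deriv

/-! ### Uniform bounds near `T 0` and stability of the invariant density -/

theorem bounds_of_c2Dist_le {T S : ExpandingCircleMap} {ε : ℝ} (hε : 0 ≤ ε)
    (h : c2Dist T S ≤ ENNReal.ofReal ε) :
    (∀ x : UnitAddCircle, ‖T x - S x‖ ≤ ε) ∧ (∀ x, |deriv T.lift x - deriv S.lift x| ≤ ε) ∧
      ∀ x, |deriv (deriv T.lift) x - deriv (deriv S.lift) x| ≤ ε := by
  have hn : ∀ {E : Type} [SeminormedAddCommGroup E] (y : E), ‖y‖ₑ ≤ ENNReal.ofReal ε → ‖y‖ ≤ ε :=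
    fun y hy => by rwa [← ofReal_norm, ENNReal.ofReal_le_ofReal_iff hε] at hy
  have h12 := (le_add_right le_rfl).trans h
  refine ⟨fun x => hn (T x - S x) ?_, fun x => hn (deriv T.lift x - deriv S.lift x) ?_,
    fun x => hn (deriv (deriv T.lift) x - deriv (deriv S.lift) x) ?_⟩
  · exact (le_iSup (fun x : UnitAddCircle => ‖T x - S x‖ₑ) x).trans
      ((le_add_right le_rfl).trans h12)
  · exact (le_iSup (fun x : ℝ => ‖deriv T.lift x - deriv S.lift x‖ₑ) x).trans
      ((le_add_left le_rfl).trans h12)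
  · exact (le_iSup (fun x : ℝ => ‖deriv (deriv T.lift) x - deriv (deriv S.lift) x‖ₑ) x).trans
      ((le_add_left le_rfl).trans h)

namespace ExpandingCircleMap

/-- Giving up half of the excess `lam - 1` and one unit in `B` yields constants shared by all nearby
maps, hence a coupling rate independent of `δ`. -/
theorem HasBounds.of_near {T S : ExpandingCircleMap} {lam B ε : ℝ} (hS : S.HasBounds lam B)
    (h1 : ∀ x, |deriv T.lift x - deriv S.lift x| ≤ ε)
    (h2 : ∀ x, |deriv (deriv T.lift) x - deriv (deriv S.lift) x| ≤ ε)
    (hε1 : ε ≤ 1) (hε2 : ε ≤ (lam - 1) / 2) : T.HasBounds ((lam + 1) / 2) (B + 1) where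
  one_lt := by linarith [hS.one_lt]
  nonneg := by linarith [hS.nonneg]
  le_deriv x := by
    have := abs_sub_abs_le_abs_sub (deriv S.lift x) (deriv T.lift x)
    rw [abs_sub_comm] at this
    linarith [hS.le_deriv x, h1 x]
  deriv₂_le x := by
    have := abs_sub_abs_le_abs_sub (deriv (deriv T.lift) x) (deriv (deriv S.lift) x)
    linarith [hS.deriv₂_le x, h2 x]

theorem exists_rate {lam B : ℝ} (hlam : 1 < lam) (hB : 0 ≤ B) : ∃ a, 0 < a ∧ a / lam + B < a := by
  have h0 : 0 < lam - 1 := by linarith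
  -- The solution of `a - a / lam = B + 1`.
  refine ⟨(B + 1) * lam / (lam - 1), by positivity, ?_⟩
  have e : (B + 1) * lam / (lam - 1) / lam = (B + 1) * lam / (lam - 1) - (B + 1) := by
    field_simp
    ring
  linarith

variable {T S : ExpandingCircleMap} {lam B a : ℝ}

theorem HasBounds.exists_isInvariantDensity (hT : T.HasBounds lam B) (ha : 0 < a)
    (hlt : a / lam + B < a) : ∃ h : CircleL1, LogLipschitz a h ∧ pairing h 1 = 1 ∧
      T.transfer h = h ∧ IsInvariantDensity T h ∧
      ∀ g, IsInvariantDensity T g → g =ᵐ[volume] h := by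
  obtain ⟨h, hh, hh1, hfix⟩ := hT.exists_fixed ha hlt
  refine ⟨h, hh, hh1, hfix, T.isInvariantDensity_iff.2 ⟨L1.integrable_coeFn h,
    ae_nonneg_of_pairing_nonneg hh.nonneg, ?_, ?_⟩, fun g hg => ?_⟩
  · rwa [Integrable.toL1_coeFn]
  · rwa [Integrable.toL1_coeFn]
  · obtain ⟨hgi, -, hg1, hgf⟩ := T.isInvariantDensity_iff.1 hg
    rw [← hT.eq_of_fixed ha hlt hh hh1 hfix hg1 hgf]
    exact hgi.coeFn_toL1.symm

theorem exists_isInvariantDensity (T : ExpandingCircleMap) :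
    ∃ h : UnitAddCircle → ℝ, IsInvariantDensity T h ∧
      ∀ g : UnitAddCircle → ℝ, IsInvariantDensity T g → g =ᵐ[volume] h := by
  obtain ⟨lam, B, hT⟩ := T.exists_hasBounds
  obtain ⟨a, ha, hlt⟩ := exists_rate hT.one_lt hT.nonneg
  obtain ⟨h, -, -, -, hh⟩ := hT.exists_isInvariantDensity ha hlt
  exact ⟨h, hh⟩

/-- Telescoping: the iterates under `T` stay in the cone, so each step adds at most `c`, and `S`
does not enlarge the errors already made. -/
theorem HasBounds.norm_pow_transfer_sub_pow_le (hT : T.HasBounds lam B) (ha : 0 < a)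
    (hlt : a / lam + B < a) {c : ℝ} (hc : ∀ g, LogLipschitz a g → pairing g 1 = 1 →
      ‖T.transfer g - S.transfer g‖ ≤ c) {f : CircleL1} (hf : LogLipschitz a f)
    (hf1 : pairing f 1 = 1) (n : ℕ) :
    ‖(T.transfer ^ n) f - (S.transfer ^ n) f‖ ≤ n * c := by
  induction n with
  | zero => simp
  | succ n ih =>
    have e : (T.transfer ^ (n + 1)) f - (S.transfer ^ (n + 1)) f
        = (T.transfer ((T.transfer ^ n) f) - S.transfer ((T.transfer ^ n) f))
          + S.transfer ((T.transfer ^ n) f - (S.transfer ^ n) f) := by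
      rw [pow_succ', pow_succ', mul_apply_eq_comp, mul_apply_eq_comp, map_sub]
      abel
    have h1 := hc _ (hT.logLipschitz_pow_transfer ha hlt hf n)
      ((T.pairing_pow_transfer_one f n).trans hf1)
    have h2 := (S.norm_transfer_le _).trans ih
    rw [e]
    refine (norm_add_le _ _).trans ((add_le_add h1 h2).trans_eq ?_)
    push_cast
    ring

theorem HasBounds.norm_fixed_sub_fixed_le (hT : T.HasBounds lam B) (hS : S.HasBounds lam B)
    (ha : 0 < a) (hlt : a / lam + B < a) {c : ℝ} (hc : ∀ g, LogLipschitz a g →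
      pairing g 1 = 1 → ‖T.transfer g - S.transfer g‖ ≤ c) {f g : CircleL1}
    (hf : LogLipschitz a f) (hf1 : pairing f 1 = 1) (hfT : T.transfer f = f)
    (hg : LogLipschitz a g) (hg1 : pairing g 1 = 1) (hgS : S.transfer g = g) (n : ℕ) :
    ‖g - f‖ ≤ 2 * (1 - couplingRate lam B a) ^ n + n * c := by
  have e : g - f = -((T.transfer ^ n) f - (S.transfer ^ n) f) + (S.transfer ^ n) (g - f) := by
    rw [map_sub, pow_transfer_eq_self hfT, pow_transfer_eq_self hgS]
    abel
  have h1 := hT.norm_pow_transfer_sub_pow_le ha hlt hc hf hf1 n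
  have h2 := hS.norm_pow_transfer_sub_le ha hlt n hg hg1 hf hf1
  rw [e]
  refine (norm_add_le _ _).trans ?_
  rw [norm_neg]
  linarith

end ExpandingCircleMap

/-- The choice `n = ⌈log δ / log q⌉` makes `qⁿ ≤ δ`, while `n` exceeds `|log δ| / |log q|` by at
most one. -/
theorem isBigO_mul_log_of_forall_le {u : ℝ → ℝ} {q M : ℝ} (hq0 : 0 < q) (hq1 : q < 1)
    (hM : 0 ≤ M) (hu0 : ∀ δ, 0 ≤ u δ)
    (hu : ∀ᶠ δ in 𝓝[>] (0 : ℝ), ∀ n : ℕ, u δ ≤ 2 * q ^ n + n * (M * δ)) :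
    u =O[𝓝[>] (0 : ℝ)] fun δ => δ * Real.log δ := by
  have hlq : Real.log q < 0 := Real.log_neg hq0 hq1
  refine IsBigO.of_bound (2 + M * (1 / -Real.log q) + M) ?_
  -- For `δ < exp (-1)` one has `|log δ| ≥ 1`, so terms of order `δ` are absorbed in `δ |log δ|`.
  filter_upwards [hu, Ioo_mem_nhdsGT (Real.exp_pos (-1))] with δ h hδ
  have hδ0 : 0 < δ := hδ.1
  have hlog : 1 ≤ -Real.log δ := by
    have := Real.log_lt_log hδ0 hδ.2
    rw [Real.log_exp] at this
    linarith
  set r := Real.log δ / Real.log q with hr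
  have hr0 : 0 ≤ r := div_nonneg_of_nonpos (by linarith) hlq.le
  have hn1 := Nat.le_ceil r
  have hn2 := (Nat.ceil_lt_add_one hr0).le
  set n := ⌈r⌉₊
  have hqn : q ^ n ≤ δ := by
    rw [← Real.log_le_log_iff (pow_pos hq0 n) hδ0, Real.log_pow]
    have := mul_le_mul_of_nonpos_right hn1 hlq.le
    rwa [hr, div_mul_cancel₀ _ hlq.ne] at this
  have hre : r = (-Real.log δ) * (1 / -Real.log q) := by
    rw [hr, mul_one_div, neg_div_neg_eq]
  rw [Real.norm_of_nonneg (hu0 δ), norm_mul, Real.norm_of_nonneg hδ0.le, Real.norm_eq_abs,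
    abs_of_neg (by linarith : Real.log δ < 0)]
  have h1 := h n
  have h2 : (n : ℝ) * (M * δ) ≤ (r + 1) * (M * δ) :=
    mul_le_mul_of_nonneg_right hn2 (mul_nonneg hM hδ0.le)
  have h3 : δ ≤ δ * -Real.log δ := le_mul_of_one_le_right hδ0.le hlog
  have h4 : M * δ ≤ M * (δ * -Real.log δ) := mul_le_mul_of_nonneg_left h3 hM
  rw [hre] at h2
  nlinarith

end

/-! ### Assembly of the main theorem -/

theorem mainTheorem9 (T : ℝ → ExpandingCircleMap) (K : ℝ)
    (hT : ∀ δ ∈ Set.Icc (0 : ℝ) 1, c2Dist (T δ) (T 0) ≤ ENNReal.ofReal (K * δ)) :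
    (∃ C : ℝ, ∀ δ ∈ Set.Icc (0 : ℝ) 1, ∀ f f' : UnitAddCircle → ℝ, HasW11Deriv f f' →
      l1Norm (fun x => transferOp (T δ) f x - transferOp (T 0) f x)
        ≤ C * δ * (l1Norm f + l1Norm f')) ∧
    (∀ δ ∈ Set.Icc (0 : ℝ) 1, ∃ h : UnitAddCircle → ℝ, IsInvariantDensity (T δ) h ∧
      ∀ g : UnitAddCircle → ℝ, IsInvariantDensity (T δ) g → g =ᵐ[volume] h) ∧
    (∀ h : ℝ → UnitAddCircle → ℝ, (∀ δ ∈ Set.Icc (0 : ℝ) 1, IsInvariantDensity (T δ) (h δ)) →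
      (fun δ : ℝ => l1Norm (fun x => h 0 x - h δ x))
        =O[𝓝[>] (0 : ℝ)] (fun δ : ℝ => δ * Real.log δ)) := by
  obtain ⟨lam, B, h0⟩ := (T 0).exists_hasBounds
  set k := max K 0 with hk
  have hk0 : 0 ≤ k := le_max_right _ _
  have hB := h0.nonneg
  have hlam := h0.one_lt
  have hnear := fun δ (hδ : δ ∈ Set.Icc (0 : ℝ) 1) => bounds_of_c2Dist_le (mul_nonneg hk0 hδ.1)
    ((hT δ hδ).trans (ENNReal.ofReal_le_ofReal
      (mul_le_mul_of_nonneg_right (le_max_left K 0) hδ.1)))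
  refine ⟨⟨k * (9 + B), fun δ hδ f f' hf => ?_⟩,
    fun δ _ => (T δ).exists_isInvariantDensity, fun h hh => ?_⟩
  · set F := hf.integrable.toL1 f
    have hV0 : 0 ≤ l1Norm f' := integral_nonneg fun x => abs_nonneg _
    have hF : ‖F‖ = l1Norm f := norm_toL1_eq_l1Norm hf.integrable
    have hF0 : 0 ≤ l1Norm f := hF ▸ norm_nonneg F
    have hkδ : 0 ≤ k * δ := mul_nonneg hk0 hδ.1
    have e : l1Norm (fun x => transferOp (T δ) f x - transferOp (T 0) f x)
        = ‖(T δ).transfer F - (T 0).transfer F‖ := by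
      rw [← (T δ).toL1_transferOp hf.integrable, ← (T 0).toL1_transferOp hf.integrable,
        ← Integrable.toL1_sub]
      exact (norm_toL1_eq_l1Norm _).symm
    rw [e]
    -- The comparison of operators needs `k δ ≤ 1 / 4`. Otherwise the trivial bound `2 ‖f‖ ≤ 8 k δ
    -- ‖f‖` suffices, whence `9 + B = (1 + B) + 8`.
    rcases le_total (k * δ) (1 / 4) with hle | hle
    · obtain ⟨n0, n1, -⟩ := hnear δ hδ
      have := h0.norm_transfer_sub_le hkδ hle n0 n1 hf.hasVariationLE hV0
      rw [hF] at this
      refine this.trans ?_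
      have : k * δ * ((1 + B) * l1Norm f + l1Norm f')
          ≤ k * δ * ((9 + B) * (l1Norm f + l1Norm f')) :=
        mul_le_mul_of_nonneg_left (by nlinarith) hkδ
      linarith
    · have := (T δ).norm_transfer_sub_le_two (T 0) F
      rw [hF] at this
      have h1 : 2 * l1Norm f ≤ 8 * (k * δ) * l1Norm f :=
        mul_le_mul_of_nonneg_right (by linarith) hF0
      have h2 : 0 ≤ k * δ * ((1 + B) * l1Norm f + (9 + B) * l1Norm f') := by positivity
      linarith
  · have hlam' : 1 < (lam + 1) / 2 := by linarith
    obtain ⟨a, ha, hlt⟩ := ExpandingCircleMap.exists_rate hlam' (by linarith : 0 ≤ B + 1)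
    -- `T 0` is given the weakened constants too, so that both maps share one cone and one rate.
    have h0' : (T 0).HasBounds ((lam + 1) / 2) (B + 1) :=
      h0.of_near (ε := 0) (by simp) (by simp) zero_le_one (by linarith)
    have hM : 0 ≤ k * (1 + B + a) := by positivity
    refine isBigO_mul_log_of_forall_le (q := 1 - couplingRate ((lam + 1) / 2) (B + 1) a)
      (M := k * (1 + B + a)) (sub_pos.2 (h0'.couplingRate_lt_one ha))
      (sub_lt_self _ (h0'.couplingRate_pos ha hlt)) hM
      (fun δ => integral_nonneg fun x => abs_nonneg _) ?_
    have hev : ∀ᶠ δ in 𝓝[>] (0 : ℝ), k * δ < min (1 / 4) ((lam - 1) / 2) := by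
      have : Tendsto (fun δ : ℝ => k * δ) (𝓝[>] 0) (𝓝 (k * 0)) :=
        (continuous_const.mul continuous_id).continuousAt.tendsto.mono_left nhdsWithin_le_nhds
      rw [mul_zero] at this
      exact this.eventually_lt_const (lt_min (by norm_num) (by linarith))
    filter_upwards [hev, Ioo_mem_nhdsGT (zero_lt_one' ℝ)] with δ hδ hδ1 n
    obtain ⟨hδa, hδb⟩ := lt_min_iff.1 hδ
    have hmem : δ ∈ Set.Icc (0 : ℝ) 1 := ⟨hδ1.1.le, hδ1.2.le⟩
    obtain ⟨n0, n1, n2⟩ := hnear δ hmem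
    have hTδ := h0.of_near n1 n2 (by linarith) hδb.le
    obtain ⟨f, hf, hf1, hfix, -, hfu⟩ := hTδ.exists_isInvariantDensity ha hlt
    obtain ⟨g, hg, hg1, hgfix, -, hgu⟩ := h0'.exists_isInvariantDensity ha hlt
    have e : l1Norm (fun x => h 0 x - h δ x) = ‖g - f‖ := by
      rw [norm_eq_l1Norm]
      refine integral_congr_ae ?_
      filter_upwards [hfu _ (hh δ hmem), hgu _ (hh 0 ⟨le_rfl, zero_le_one⟩),
        Lp.coeFn_sub g f] with x hx1 hx2 hx3
      rw [hx1, hx2, hx3, Pi.sub_apply]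
    rw [e]
    refine hTδ.norm_fixed_sub_fixed_le h0' ha hlt (fun u hu hu1 => ?_) hf hf1 hfix hg hg1 hgfix n
    have hu_norm := hu.norm_eq_one hu1
    -- A cone density of mass one has variation at most `a`, which gives the one-step error `k δ (1
    -- + B + a)`.
    have := h0.norm_transfer_sub_le (mul_nonneg hk0 hmem.1) hδa.le n0 n1
      (hu.hasVariationLE ha.le) (by positivity)
    rw [hu_norm] at this
    linarith
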